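/- **Theorem 1.** Let $M$ be a smooth manifold with a Poisson bracket $\{\,,\}$ on $C^\infty(M)$, let $\Lambda$ be its Poisson bivector, i.e. $\{f,g\}=\Lambda(df,dg)$, and let $\sharp:T^*M\to TM$, $\alpha\mapsto\alpha^\sharp$, be the bundle map with $\beta(\alpha^\sharp)=\Lambda(\alpha,\beta)$. Assume that $(M,\Lambda)$ is regular, i.e. that the rank of $\sharp_x$ does not depend on $x\in M$. Let $\mathcal F$ be the symplectic foliation, so that $T\mathcal F=\sharp(T^*M)$, and fix a smooth transversal distribution $\nu\mathcal F$, so that $TM=T\mathcal F\oplus\nu\mathcal F$ and dually $T^*M=T^*\mathcal F\oplus\nu^*\mathcal F$, where $\nu^*\mathcal F$ is the annihilator of $T\mathcal F$. Let $I(M)$ be the algebra of Casimir functions, i.e. of those $f\in C^\infty(M)$ with $(df)^\sharp=0$. Let $\Omega_{0,q}(M)$ (resp. $\mathcal V_{0,q}(M)$) be the space of smooth sections of $\wedge^q(T^*\mathcal F)$ (resp. $\wedge^q(T\mathcal F)$), i.e. of the $q$-forms that vanish as soon as one argument is in $\nu\mathcal F$ (resp. of the $q$-vector fields that vanish as soon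 as one argument is in $\nu^*\mathcal F$). Let $\sigma=[\Lambda,\cdot\,]$ be the Lichnerowicz–Poisson coboundary on multivector fields; explicitly, $$\sigma Q(\alpha_0,\dots,\alpha_q)=\sum_{i}(-1)^i\alpha_i^\sharp\bigl(Q(\alpha_0,\dots,\widehat{\alpha_i},\dots,\alpha_q)\bigr)+\sum_{i<j}(-1)^{i+j}Q(\{\alpha_i,\alpha_j\},\alpha_0,\dots,\widehat{\alpha_i},\dots,\widehat{\alpha_j},\dots,\alpha_q)$$ for 1-forms $\alpha_i$, where $\{\alpha,\beta\}=L_{\alpha^\sharp}\beta-L_{\beta^\sharp}\alpha-d(\Lambda(\alpha,\beta))$. For $\eta\in\Omega_{0,q}(M)$ and $Q\in\mathcal V_{0,q}(M)$ let $d''\eta\in\Omega_{0,q+1}(M)$ and $\sigma''Q\in\mathcal V_{0,q+1}(M)$ be the components of type $(0,q+1)$ of $d\eta$ and of $\sigma Q$ with respect to the decompositions above. Both operators are $I(M)$-linear. Then $d''\circ d''=0$ and $\sigma''\circ\sigma''=0$, and the complexes $\bigl(\bigoplus_q\mathcal V_{0,q}(M),\sigma''\bigr)$ and $\bigl(\bigoplus_q\Omega_{0,q}(M),d''\bigr)$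 are isomorphic as complexes of $I(M)$-modules. More precisely, let $$(\tilde\sharp\eta)(\alpha_1,\dots,\alpha_q)=(-1)^q\,\eta(\alpha_1^\sharp,\dots,\alpha_q^\sharp)$$ be the extension of $\sharp$ to $q$-forms; then $\tilde\sharp$ restricts to isomorphisms of $I(M)$-modules $\Omega_{0,q}(M)\to\mathcal V_{0,q}(M)$ for all $q\ge 0$ with $\sigma''\circ\tilde\sharp=-\tilde\sharp\circ d''$, so that the maps $(-1)^q\tilde\sharp$ form an isomorphism of complexes. In particular, for every $q\ge0$, the tangential Poisson cohomology $$H^q_{\Lambda,tan}(M)=\frac{\ker(\sigma'':\mathcal V_{0,q}(M)\to\mathcal V_{0,q+1}(M))}{\operatorname{im}(\sigma'':\mathcal V_{0,q-1}(M)\to\mathcal V_{0,q}(M))}$$ and the leafwise de Rham cohomology $$H^q(M,\mathcal P^0(\mathcal F))=\frac{\ker(d'':\Omega_{0,q}(M)\to\Omega_{0,q+1}(M))}{\operatorname{im}(d'':\Omega_{0,q-1}(M)\to\Omega_{0,q}(M))}$$ are isomorphic $I(M)$-modules, via the isomorphism of complexes above. -/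

import Mathlib

open Set Function Bundle VectorField
open scoped Manifold ContDiff Topology

set_option linter.unusedSectionVars false

noncomputable section

namespace PoissonGeometry

section Basic

variable (E : Type*) [NormedAddCommGroup E] [NormedSpace ℝ E]
  (M : Type*) [TopologicalSpace M] [ChartedSpace E M]

/-- The ring `C^∞(M)` of smooth real-valued functions. -/
abbrev SmoothFun : Type _ := C^∞⟮𝓘(ℝ, E), M; ℝ⟯

/-- The cotangent space `T*_x M`. -/
abbrev CotangentSpace (x : M) : Type _ := Module.Dual ℝ (TangentSpace 𝓘(ℝ, E) x)

variable [IsManifold 𝓘(ℝ, E) ∞ M]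

/-- The smooth vector fields on `M`. -/
abbrev VectorFields : Type _ :=
  Cₛ^∞⟮𝓘(ℝ, E); E, (TangentSpace 𝓘(ℝ, E) : M → Type _)⟯

variable {E M}

instance : SMul (SmoothFun E M) (VectorFields E M) :=
  ⟨fun f X => ⟨fun x => f x • X x, f.contMDiff.smul_section X.contMDiff⟩⟩

@[simp] theorem vectorFields_smul_apply (f : SmoothFun E M) (X : VectorFields E M) (x : M) :
    (f • X) x = f x • X x := rfl

instance : Module (SmoothFun E M) (VectorFields E M) where
  one_smul X := by ext x; simp
  mul_smul f g X := by ext x; simp [mul_smul]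
  smul_zero f := by ext x; simp
  smul_add f X Y := by ext x; simp
  add_smul f g X := by ext x; simp [add_smul]
  zero_smul X := by ext x; simp

instance : IsScalarTower ℝ (SmoothFun E M) (VectorFields E M) :=
  ⟨fun c f X => by ext x; simp [mul_smul]⟩

/-- The derivative of a smooth function along a vector field is smooth. -/
theorem contMDiff_mvfderiv_apply (f : SmoothFun E M) (X : VectorFields E M) :
    ContMDiff 𝓘(ℝ, E) 𝓘(ℝ, ℝ) ∞ (fun x => mvfderiv 𝓘(ℝ, E) (f : M → ℝ) x (X x)) := by
  have h1 := f.contMDiff.contMDiff_tangentMap (m := ∞) (by simp)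
  have h2 := h1.comp X.contMDiff
  exact (contMDiff_snd_tangentBundle_modelSpace ℝ 𝓘(ℝ, ℝ)).comp h2

/-- A vector field as a derivation of `C^∞(M)`: `X ↦ (f ↦ X f)`. -/
def VectorFields.derivation :
    VectorFields E M →ₗ[SmoothFun E M] Derivation ℝ (SmoothFun E M) (SmoothFun E M) where
  toFun X := Derivation.mk'
    { toFun := fun f => ⟨_, contMDiff_mvfderiv_apply f X⟩
      map_add' := fun f g => by
        ext x
        exact congrArg (fun l => l (X x)) (mvfderiv_add
          (f.contMDiff.mdifferentiableAt (x := x) (by simp))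
          (g.contMDiff.mdifferentiableAt (x := x) (by simp)))
      map_smul' := fun c f => by
        ext x
        have := mvfderiv_mul (mdifferentiableAt_const (c := c) (x := x) (I := 𝓘(ℝ, E)))
          (f.contMDiff.mdifferentiableAt (x := x) (by simp))
        rw [mvfderiv_const, smul_zero, add_zero] at this
        exact congrArg (fun l => l (X x)) this }
    (fun f g => by
      ext x
      exact congrArg (fun l => l (X x)) (mvfderiv_mul
        (f.contMDiff.mdifferentiableAt (x := x) (by simp))
        (g.contMDiff.mdifferentiableAt (x := x) (by simp))))
  map_add' X Y := by
    ext f x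
    exact map_add (mvfderiv 𝓘(ℝ, E) (f : M → ℝ) x) (X x) (Y x)
  map_smul' f X := by
    ext g x
    exact map_smul (mvfderiv 𝓘(ℝ, E) (g : M → ℝ) x) (f x) (X x)

@[simp] theorem VectorFields.derivation_apply (X : VectorFields E M) (f : SmoothFun E M) (x : M) :
    VectorFields.derivation X f x = mvfderiv 𝓘(ℝ, E) (f : M → ℝ) x (X x) := rfl

instance : IsManifold 𝓘(ℝ, E) (minSmoothness ℝ 2) M :=
  IsManifold.of_le (n := ∞) (by
    rw [minSmoothness_of_isRCLikeNormedField]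
    exact ENat.LEInfty.out)

instance : IsManifold 𝓘(ℝ, E) (minSmoothness ℝ 3) M :=
  IsManifold.of_le (n := ∞) (by
    rw [minSmoothness_of_isRCLikeNormedField]
    exact ENat.LEInfty.out)

variable [CompleteSpace E]

/-- The Lie bracket of smooth vector fields. -/
def VectorFields.lie : VectorFields E M →ₗ[ℝ] VectorFields E M →ₗ[ℝ] VectorFields E M :=
  LinearMap.mk₂ ℝ
    (fun X Y => ⟨mlieBracket 𝓘(ℝ, E) X Y, fun x =>
      haveI : IsManifold 𝓘(ℝ, E) (((⊤ : ℕ∞) : WithTop ℕ∞) + 1) M :=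
        inferInstanceAs (IsManifold 𝓘(ℝ, E) ∞ M)
      ContMDiffAt.mlieBracket_vectorField (m := ⊤) (n := ⊤) X.contMDiff.contMDiffAt
        Y.contMDiff.contMDiffAt (by simp)⟩)
    (fun X Y Z => by
      ext x; exact mlieBracket_add_left X.mdifferentiableAt Y.mdifferentiableAt)
    (fun c X Y => by
      ext x; exact mlieBracket_const_smul_left X.mdifferentiableAt)
    (fun X Y Z => by
      ext x; exact mlieBracket_add_right Y.mdifferentiableAt Z.mdifferentiableAt)
    (fun c X Y => by
      ext x; exact mlieBracket_const_smul_right Y.mdifferentiableAt)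

@[simp] theorem VectorFields.lie_apply (X Y : VectorFields E M) (x : M) :
    VectorFields.lie X Y x = mlieBracket 𝓘(ℝ, E) X Y x := rfl

theorem VectorFields.lie_smul (X Y : VectorFields E M) (f : SmoothFun E M) :
    VectorFields.lie X (f • Y) =
      f • VectorFields.lie X Y + VectorFields.derivation X f • Y := by
  ext x
  have := mlieBracket_smul_right (V := (X : ∀ x : M, TangentSpace 𝓘(ℝ, E) x))
    (f.contMDiff.mdifferentiableAt (x := x) (by simp)) Y.mdifferentiableAt
  exact this.trans (add_comm _ _)

theorem VectorFields.lie_self (X : VectorFields E M) : VectorFields.lie X X = 0 := by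
  ext x; simp

end Basic

section OneForms

variable (E : Type*) [NormedAddCommGroup E] [NormedSpace ℝ E]
  (M : Type*) [TopologicalSpace M] [ChartedSpace E M] [IsManifold 𝓘(ℝ, E) ∞ M]

/-- The smooth 1-forms on `M`: families of covectors whose values on every smooth vector field are
smooth functions. -/
structure OneForms where
  toFun : ∀ x : M, CotangentSpace E M x
  smooth' : ∀ X : VectorFields E M,
    ContMDiff 𝓘(ℝ, E) 𝓘(ℝ, ℝ) ∞ (fun x => toFun x (X x))

variable {E M}

namespace OneForms

instance : DFunLike (OneForms E M) M (CotangentSpace E M) where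
  coe := toFun
  coe_injective := by rintro ⟨_, _⟩ ⟨_, _⟩ h; congr

@[ext] theorem ext {α β : OneForms E M} (h : ∀ x, α x = β x) : α = β := DFunLike.ext _ _ h

@[simp] theorem coe_mk (a : ∀ x : M, CotangentSpace E M x) (h) :
    ((⟨a, h⟩ : OneForms E M) : ∀ x : M, CotangentSpace E M x) = a := rfl

theorem smooth (α : OneForms E M) (X : VectorFields E M) :
    ContMDiff 𝓘(ℝ, E) 𝓘(ℝ, ℝ) ∞ (fun x => α x (X x)) := α.smooth' X

instance : Zero (OneForms E M) := ⟨⟨fun _ => 0, fun _ => by simpa using contMDiff_const⟩⟩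
instance : Add (OneForms E M) :=
  ⟨fun α β => ⟨fun x => α x + β x, fun X => (α.smooth X).add (β.smooth X)⟩⟩
instance : Neg (OneForms E M) := ⟨fun α => ⟨fun x => -α x, fun X => (α.smooth X).neg⟩⟩
instance : Sub (OneForms E M) :=
  ⟨fun α β => ⟨fun x => α x - β x, fun X => (α.smooth X).sub (β.smooth X)⟩⟩
instance : SMul (SmoothFun E M) (OneForms E M) :=
  ⟨fun f α => ⟨fun x => f x • α x, fun X => f.contMDiff.mul (α.smooth X)⟩⟩
instance : SMul ℝ (OneForms E M) :=
  ⟨fun c α => ⟨fun x => c • α x, fun X => contMDiff_const.mul (α.smooth X)⟩⟩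

@[simp] theorem zero_apply (x : M) : (0 : OneForms E M) x = 0 := rfl
@[simp] theorem add_apply (α β : OneForms E M) (x : M) : (α + β) x = α x + β x := rfl
@[simp] theorem neg_apply (α : OneForms E M) (x : M) : (-α) x = -α x := rfl
@[simp] theorem sub_apply (α β : OneForms E M) (x : M) : (α - β) x = α x - β x := rfl
@[simp] theorem smul_apply (f : SmoothFun E M) (α : OneForms E M) (x : M) :
    (f • α) x = f x • α x := rfl
@[simp] theorem const_smul_apply (c : ℝ) (α : OneForms E M) (x : M) :
    (c • α) x = c • α x := rfl

instance : AddCommGroup (OneForms E M) where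
  add_assoc α β γ := by ext x : 1; simp [add_assoc]
  zero_add α := by ext x : 1; simp
  add_zero α := by ext x : 1; simp
  add_comm α β := by ext x : 1; simp [add_comm]
  neg_add_cancel α := by ext x : 1; simp
  sub_eq_add_neg α β := by ext x : 1; simp [sub_eq_add_neg]
  nsmul := nsmulRec
  zsmul := zsmulRec

instance : Module (SmoothFun E M) (OneForms E M) where
  one_smul α := by ext x : 1; simp
  mul_smul f g α := by ext x : 1; simp [mul_smul]
  smul_zero f := by ext x : 1; simp
  smul_add f α β := by ext x : 1; simp
  add_smul f g α := by ext x : 1; simp [add_smul]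
  zero_smul α := by ext x : 1; simp

instance : Module ℝ (OneForms E M) where
  one_smul α := by ext x : 1; simp
  mul_smul f g α := by ext x : 1; simp [mul_smul]
  smul_zero f := by ext x : 1; simp
  smul_add f α β := by ext x : 1; simp
  add_smul f g α := by ext x : 1; simp [add_smul]
  zero_smul α := by ext x : 1; simp

instance : IsScalarTower ℝ (SmoothFun E M) (OneForms E M) :=
  ⟨fun c f X => by ext x : 1; simp [mul_smul]⟩

/-- The pairing of 1-forms with vector fields. -/
def pair : OneForms E M →ₗ[SmoothFun E M] VectorFields E M →ₗ[SmoothFun E M] SmoothFun E M :=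
  LinearMap.mk₂ _ (fun α X => ⟨fun x => α x (X x), α.smooth X⟩)
    (fun _ _ _ => rfl) (fun _ _ _ => rfl)
    (fun α X Y => by ext x; exact map_add (α x) (X x) (Y x))
    (fun f α X => by ext x; exact map_smul (α x) (f x) (X x))

@[simp] theorem pair_apply (α : OneForms E M) (X : VectorFields E M) (x : M) :
    pair α X x = α x (X x) := rfl

/-- The differential of a smooth function. -/
def d (f : SmoothFun E M) : OneForms E M :=
  ⟨fun x => (mvfderiv 𝓘(ℝ, E) (f : M → ℝ) x).toLinearMap, contMDiff_mvfderiv_apply f⟩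

theorem d_apply (f : SmoothFun E M) (x : M) (v : TangentSpace 𝓘(ℝ, E) x) :
    d f x v = mvfderiv 𝓘(ℝ, E) (f : M → ℝ) x v := rfl

end OneForms

/-- Near every point, `M` has smooth frames, cut off so as to be globally defined: vector fields
`s i` and 1-forms `θ i` with `∑ i, θ i v • s i = χ v`, where `χ = 1` near `x₀`. -/
theorem exists_frame [FiniteDimensional ℝ E] [T2Space M] (x₀ : M) :
    ∃ (n : ℕ) (s : Fin n → VectorFields E M) (θ : Fin n → OneForms E M) (χ : SmoothFun E M),
      (∀ᶠ y in 𝓝 x₀, χ y = 1) ∧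
        ∀ (y : M) (v : TangentSpace 𝓘(ℝ, E) y), χ y • v = ∑ i, θ i y v • s i y := by
  classical
  let e := trivializationAt E (TangentSpace 𝓘(ℝ, E) : M → Type _) x₀
  let b := Module.finBasis ℝ E
  have he : x₀ ∈ e.baseSet := FiberBundle.mem_baseSet_trivializationAt' x₀
  obtain ⟨ψ, hψ⟩ := (SmoothBumpFunction.nhds_basis_support (I := 𝓘(ℝ, E))
    (e.open_baseSet.mem_nhds he)).ex_mem
  have hs : ∀ i, ContMDiff 𝓘(ℝ, E) (𝓘(ℝ, E).prod 𝓘(ℝ, E)) ∞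
      (fun y => TotalSpace.mk' E y (((ψ : M → ℝ) • e.localFrame b i) y)) := fun i =>
    ContMDiffOn.smul_section_of_tsupport (ψ.contMDiff.contMDiffOn) e.open_baseSet hψ
      (e.contMDiffOn_localFrame_baseSet ∞ b i)
  have hθ : ∀ (i) (X : VectorFields E M), ContMDiff 𝓘(ℝ, E) 𝓘(ℝ, ℝ) ∞
      (fun y => ((ψ y) • e.localFrameCoeff 𝓘(ℝ, E) b i y) (X y)) := by
    intro i X
    refine contMDiff_of_tsupport fun y hy => ?_
    have hy' : y ∈ e.baseSet := hψ (closure_mono (fun z hz => by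
      contrapose! hz
      simp at hz ⊢
      simp [hz]) hy)
    exact ψ.contMDiff.contMDiffAt.mul
      (contMDiffAt_localFrameCoeff b hy' X.contMDiff.contMDiffAt i)
  refine ⟨_, fun i => ⟨_, hs i⟩, fun i => ⟨_, hθ i⟩,
    ⟨_, ψ.contMDiff⟩ * ⟨_, ψ.contMDiff⟩, ?_, ?_⟩
  · filter_upwards [ψ.eventuallyEq_one] with y hy
    change ψ y * ψ y = 1
    simp [hy]
  · intro y v
    change (ψ y * ψ y) • v =
      ∑ i, (ψ y * e.localFrameCoeff 𝓘(ℝ, E) b i y v) • (ψ y • e.localFrame b i y)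
    by_cases hy : y ∈ e.baseSet
    · have h := e.eq_sum_localFrameCoeff_smul (I := 𝓘(ℝ, E)) (b := b)
        (s := Function.update (0 : ∀ y : M, TangentSpace 𝓘(ℝ, E) y) y v) hy
      simp only [Function.update_self] at h
      conv_lhs => rw [h]
      rw [Finset.smul_sum]
      refine Finset.sum_congr rfl fun i _ => ?_
      rw [smul_smul, smul_smul]
      congr 1
      ring
    · have : ψ y = 0 := by
        by_contra h
        exact hy (hψ (subset_closure h))
      simp [this]

end OneForms
section Commutator

variable {E : Type*} [NormedAddCommGroup E] [NormedSpace ℝ E] [CompleteSpace E]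
  {M : Type*} [TopologicalSpace M] [ChartedSpace E M] [IsManifold 𝓘(ℝ, E) ∞ M]

theorem fderiv_chart_inverse (f : SmoothFun E M) (x : M) {y : E}
    (hy : y ∈ (extChartAt 𝓘(ℝ, E) x).target)
    (v : TangentSpace 𝓘(ℝ, E) ((extChartAt 𝓘(ℝ, E) x).symm y)) :
    fderiv ℝ ((f : M → ℝ) ∘ (extChartAt 𝓘(ℝ, E) x).symm) y
      ((mfderivWithin 𝓘(ℝ, E) 𝓘(ℝ, E) (extChartAt 𝓘(ℝ, E) x).symm
        (range 𝓘(ℝ, E)) y).inverse v) =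
    mvfderiv 𝓘(ℝ, E) (f : M → ℝ) ((extChartAt 𝓘(ℝ, E) x).symm y) v := by
  have : IsManifold 𝓘(ℝ, E) 1 M := IsManifold.of_le (n := ∞) (by simp)
  have hinv := isInvertible_mfderivWithin_extChartAt_symm hy
  obtain ⟨u, rfl⟩ : ∃ u, mfderivWithin 𝓘(ℝ, E) 𝓘(ℝ, E) (extChartAt 𝓘(ℝ, E) x).symm
      (range 𝓘(ℝ, E)) y u = v := by
    obtain ⟨e, he⟩ := hinv
    exact ⟨e.symm v, by rw [← he]; exact e.apply_symm_apply v⟩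
  rw [hinv.inverse_apply_self]
  have hd : MDifferentiableAt 𝓘(ℝ, E) 𝓘(ℝ, E) (extChartAt 𝓘(ℝ, E) x).symm y := by
    have := mdifferentiableWithinAt_extChartAt_symm (I := 𝓘(ℝ, E)) hy
    rwa [modelWithCornersSelf_coe, range_id, mdifferentiableWithinAt_univ] at this
  have hc := mfderiv_comp y (f.contMDiff.mdifferentiableAt
    (x := (extChartAt 𝓘(ℝ, E) x).symm y) (by simp)) hd
  rw [mfderiv_eq_fderiv] at hc
  rw [hc]
  simp only [modelWithCornersSelf_coe, range_id, mfderivWithin_univ]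
  rfl

theorem mvfderiv_mlieBracket (f : SmoothFun E M) (X Y : VectorFields E M) (x : M) :
    mvfderiv 𝓘(ℝ, E) (f : M → ℝ) x (mlieBracket 𝓘(ℝ, E) X Y x) =
      mvfderiv 𝓘(ℝ, E) (VectorFields.derivation Y f : M → ℝ) x (X x) -
      mvfderiv 𝓘(ℝ, E) (VectorFields.derivation X f : M → ℝ) x (Y x) := by
  have : IsManifold 𝓘(ℝ, E) 1 M := IsManifold.of_le (n := ∞) (by simp)
  have : IsManifold 𝓘(ℝ, E) 2 M := IsManifold.of_le (n := ∞) ENat.LEInfty.out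
  have hr : range 𝓘(ℝ, E) = (univ : Set E) := range_id
  let φ := extChartAt 𝓘(ℝ, E) x
  let g : E → ℝ := (f : M → ℝ) ∘ φ.symm
  let pb : VectorFields E M → E → E := fun Z =>
    mpullbackWithin 𝓘(ℝ, E) 𝓘(ℝ, E) φ.symm Z (range 𝓘(ℝ, E))
  have hx : φ x ∈ φ.target := mem_extChartAt_target x
  have hpb : ∀ (h : SmoothFun E M) (Z : VectorFields E M) (y : E), y ∈ φ.target →
      fderiv ℝ ((h : M → ℝ) ∘ φ.symm) y (pb Z y) = VectorFields.derivation Z h (φ.symm y) :=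
    fun h Z y hy => fderiv_chart_inverse h x hy _
  have hφ : φ.symm (φ x) = x := extChartAt_to_inv x
  have hdiff : ∀ Z : VectorFields E M, DifferentiableAt ℝ (pb Z) (φ x) := fun Z => by
    have := MDifferentiableWithinAt.differentiableWithinAt_mpullbackWithin_vectorField
      (I := 𝓘(ℝ, E)) (Z.mdifferentiableAt (x := x)).mdifferentiableWithinAt (s := univ)
    rw [preimage_univ, univ_inter] at this
    rw [← differentiableWithinAt_univ, ← hr]
    exact this
  have hg : ContDiffAt ℝ ∞ g (φ x) := by
    have h1 : ContMDiffWithinAt 𝓘(ℝ, E) 𝓘(ℝ, E) ∞ φ.symm (range 𝓘(ℝ, E)) (φ x) :=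
      contMDiffWithinAt_extChartAt_symm_range x hx
    rw [modelWithCornersSelf_coe, range_id, contMDiffWithinAt_univ] at h1
    exact (f.contMDiff.contMDiffAt.comp (φ x) h1).contDiffAt
  have hev : ∀ᶠ y in 𝓝 (φ x), y ∈ φ.target := by
    have := extChartAt_target_mem_nhds (I := 𝓘(ℝ, E)) x
    exact this
  have hd : ∀ Z W : VectorFields E M,
      fderiv ℝ (fun y => fderiv ℝ g y (pb W y)) (φ x) (pb Z (φ x)) =
      VectorFields.derivation Z (VectorFields.derivation W f) x := fun Z W => by
    have : (fun y => fderiv ℝ g y (pb W y)) =ᶠ[𝓝 (φ x)]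
        ((VectorFields.derivation W f : SmoothFun E M) : M → ℝ) ∘ φ.symm := by
      filter_upwards [hev] with y hy
      exact hpb f W y hy
    rw [this.fderiv_eq, hpb _ _ _ hx, hφ]
  have hbr := fderiv_apply_lieBracket hg (by
    rw [minSmoothness_of_isRCLikeNormedField]; exact ENat.LEInfty.out) (hdiff Y) (hdiff X)
  rw [hd, hd] at hbr
  refine Eq.trans ?_ hbr
  -- the bracket in the chart
  have h2 : mlieBracket 𝓘(ℝ, E) X Y x =
      (mfderiv 𝓘(ℝ, E) 𝓘(ℝ, E) φ x).inverse
        (lieBracket ℝ (pb X) (pb Y) (φ x) : E) := by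
    have h8 : lieBracketWithin ℝ (pb X) (pb Y) (range 𝓘(ℝ, E)) (φ x) =
        lieBracket ℝ (pb X) (pb Y) (φ x) := by rw [hr, lieBracketWithin_univ]
    rw [← mlieBracketWithin_univ, mlieBracketWithin_apply, preimage_univ, univ_inter]
    exact congrArg (fun u : E => (mfderiv 𝓘(ℝ, E) 𝓘(ℝ, E) φ x).inverse u) h8
  have hfd : ∀ v : TangentSpace 𝓘(ℝ, E) x, mvfderiv 𝓘(ℝ, E) (f : M → ℝ) x v =
      fderiv ℝ g (φ x) (mfderiv 𝓘(ℝ, E) 𝓘(ℝ, E) φ x v) := fun v => by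
    have h3 : MDifferentiableAt 𝓘(ℝ, E) 𝓘(ℝ, E) φ x :=
      mdifferentiableAt_extChartAt (mem_chart_source E x)
    have h4 : MDifferentiableAt 𝓘(ℝ, E) 𝓘(ℝ, ℝ) g (φ x) :=
      (hg.differentiableAt (by simp)).mdifferentiableAt
    have h5 := mfderiv_comp x h4 h3
    have h6 : mfderiv 𝓘(ℝ, E) 𝓘(ℝ, ℝ) (f : M → ℝ) x = mfderiv 𝓘(ℝ, E) 𝓘(ℝ, ℝ) (g ∘ φ) x := by
      refine Filter.EventuallyEq.mfderiv_eq ?_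
      filter_upwards [extChartAt_source_mem_nhds (I := 𝓘(ℝ, E)) x] with y hy
      exact congrArg f (φ.left_inv hy).symm
    have h7 := DFunLike.congr_fun h5 v
    rw [mfderiv_eq_fderiv] at h7
    exact (DFunLike.congr_fun h6 v).trans h7
  have hinv' : (mfderiv 𝓘(ℝ, E) 𝓘(ℝ, E) φ x).IsInvertible :=
    isInvertible_mfderiv_extChartAt (mem_extChartAt_source x)
  rw [h2, hfd]
  obtain ⟨e, he⟩ := hinv'
  rw [← he, ContinuousLinearMap.inverse_equiv]
  exact congrArg (fderiv ℝ g (φ x)) (e.apply_symm_apply _)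

theorem VectorFields.derivation_lie (X Y : VectorFields E M) (f : SmoothFun E M) :
    VectorFields.derivation (VectorFields.lie X Y) f =
      VectorFields.derivation X (VectorFields.derivation Y f) -
        VectorFields.derivation Y (VectorFields.derivation X f) := by
  ext x
  exact mvfderiv_mlieBracket f X Y x

end Commutator

section AlternatingFields

variable (E : Type*) [NormedAddCommGroup E] [NormedSpace ℝ E]
  {M : Type*} [TopologicalSpace M] [ChartedSpace E M]
  (V : M → Type*) [∀ x, AddCommGroup (V x)] [∀ x, Module ℝ (V x)]
  (L : Type*) [DFunLike L M V]

/-- `q`-linear alternating functions on the fibres `V x` which are smooth, i.e. take smooth values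
on the sections belonging to `L`.  It is used when `L` is the space of vector fields
(`V x = T_x M`) and when `L` is the space of 1-forms (`V x = T*_x M`). -/
structure AlternatingField (q : ℕ) where
  toFun : ∀ x : M, V x [⋀^Fin q]→ₗ[ℝ] ℝ
  smooth' : ∀ s : Fin q → L,
    ContMDiff 𝓘(ℝ, E) 𝓘(ℝ, ℝ) ∞ (fun x => toFun x (fun i => s i x))

variable {E V L} {q : ℕ}

namespace AlternatingField

instance : DFunLike (AlternatingField E V L q) M (fun x => V x [⋀^Fin q]→ₗ[ℝ] ℝ) where
  coe := toFun
  coe_injective := by rintro ⟨_, _⟩ ⟨_, _⟩ h; congr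

@[ext] theorem ext {P Q : AlternatingField E V L q} (h : ∀ x, P x = Q x) : P = Q :=
  DFunLike.ext _ _ h

@[simp] theorem coe_mk (a : ∀ x : M, V x [⋀^Fin q]→ₗ[ℝ] ℝ) (h) :
    ((⟨a, h⟩ : AlternatingField E V L q) : ∀ x : M, V x [⋀^Fin q]→ₗ[ℝ] ℝ) = a := rfl

theorem smooth (P : AlternatingField E V L q) (s : Fin q → L) :
    ContMDiff 𝓘(ℝ, E) 𝓘(ℝ, ℝ) ∞ (fun x => P x (fun i => s i x)) := P.smooth' s

instance : Zero (AlternatingField E V L q) :=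
  ⟨⟨fun _ => 0, fun _ => by simpa using contMDiff_const⟩⟩
instance : Add (AlternatingField E V L q) :=
  ⟨fun P Q => ⟨fun x => P x + Q x, fun s => (P.smooth s).add (Q.smooth s)⟩⟩
instance : Neg (AlternatingField E V L q) :=
  ⟨fun P => ⟨fun x => -P x, fun s => (P.smooth s).neg⟩⟩
instance : Sub (AlternatingField E V L q) :=
  ⟨fun P Q => ⟨fun x => P x - Q x, fun s => (P.smooth s).sub (Q.smooth s)⟩⟩
instance : SMul (SmoothFun E M) (AlternatingField E V L q) :=
  ⟨fun f P => ⟨fun x => f x • P x, fun s => f.contMDiff.mul (P.smooth s)⟩⟩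

@[simp] theorem zero_apply (x : M) : (0 : AlternatingField E V L q) x = 0 := rfl
@[simp] theorem add_apply (P Q : AlternatingField E V L q) (x : M) : (P + Q) x = P x + Q x := rfl
@[simp] theorem neg_apply (P : AlternatingField E V L q) (x : M) : (-P) x = -P x := rfl
@[simp] theorem sub_apply (P Q : AlternatingField E V L q) (x : M) : (P - Q) x = P x - Q x := rfl
@[simp] theorem smul_apply (f : SmoothFun E M) (P : AlternatingField E V L q) (x : M) :
    (f • P) x = f x • P x := rfl

instance : AddCommGroup (AlternatingField E V L q) where
  add_assoc P Q R := by ext x : 1; simp [add_assoc]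
  zero_add P := by ext x : 1; simp
  add_zero P := by ext x : 1; simp
  add_comm P Q := by ext x : 1; simp [add_comm]
  neg_add_cancel P := by ext x : 1; simp
  sub_eq_add_neg P Q := by ext x : 1; simp [sub_eq_add_neg]
  nsmul := nsmulRec
  zsmul := zsmulRec

instance : Module (SmoothFun E M) (AlternatingField E V L q) where
  one_smul P := by ext x : 1; simp
  mul_smul f g P := by ext x : 1; simp [mul_smul]
  smul_zero f := by ext x : 1; simp
  smul_add f P Q := by ext x : 1; simp
  add_smul f g P := by ext x : 1; simp [add_smul]
  zero_smul P := by ext x : 1; simp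

end AlternatingField

variable (E V L) in
/-- `L` is a `C^∞(M)`-module of sections of `V` which has cut-off local frames. -/
class IsSectionModule [AddCommGroup L] [Module ℝ L] [Module (SmoothFun E M) L] : Prop where
  coe_add : ∀ (s t : L) (x : M), (s + t) x = s x + t x
  coe_smul : ∀ (f : SmoothFun E M) (s : L) (x : M), (f • s) x = f x • s x
  exists_frame : ∀ x₀ : M, ∃ (n : ℕ) (s : Fin n → L) (θ : Fin n → ∀ x, Module.Dual ℝ (V x))
    (χ : SmoothFun E M), χ x₀ = 1 ∧
      (∀ i (t : L), ContMDiff 𝓘(ℝ, E) 𝓘(ℝ, ℝ) ∞ (fun x => θ i x (t x))) ∧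
      ∀ (x : M) (v : V x), χ x • v = ∑ i, θ i x v • s i x

section Sections

variable [AddCommGroup L] [Module ℝ L] [Module (SmoothFun E M) L]

/-- A `C^∞(M)`-multilinear alternating map is `ℝ`-multilinear. -/
def restrictAlternating [IsScalarTower ℝ (SmoothFun E M) L]
    (T : L [⋀^Fin q]→ₗ[SmoothFun E M] SmoothFun E M) : L [⋀^Fin q]→ₗ[ℝ] SmoothFun E M :=
  { T.toMultilinearMap.restrictScalars ℝ with map_eq_zero_of_eq' := T.map_eq_zero_of_eq' }

@[simp] theorem restrictAlternating_apply [IsScalarTower ℝ (SmoothFun E M) L]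
    (T : L [⋀^Fin q]→ₗ[SmoothFun E M] SmoothFun E M) (s : Fin q → L) :
    restrictAlternating T s = T s := rfl

/-- Evaluation of smooth functions at a point. -/
def evalFun (x : M) : SmoothFun E M →ₗ[ℝ] ℝ where
  toFun f := f x
  map_add' _ _ := rfl
  map_smul' _ _ := rfl



variable (E) in
/-- Evaluation of sections at a point. -/
def evalSection [IsSectionModule E V L] (x : M) : L →+ V x :=
  AddMonoidHom.mk' (fun s => s x) (fun s t => IsSectionModule.coe_add (E := E) s t x)

theorem coe_sum_section [IsSectionModule E V L] {ι : Type*} (u : Finset ι) (s : ι → L) (x : M) :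
    (∑ i ∈ u, s i) x = ∑ i ∈ u, s i x := map_sum (evalSection E x) s u

theorem coe_const_smul_section [IsScalarTower ℝ (SmoothFun E M) L] [IsSectionModule E V L]
    (c : ℝ) (s : L) (x : M) : (c • s) x = c • s x := by
  rw [← one_smul (SmoothFun E M) s, ← smul_assoc, IsSectionModule.coe_smul,
    IsSectionModule.coe_smul]
  simp

/-- Every vector in a fibre extends to a section, linearly. -/
theorem exists_lift [IsScalarTower ℝ (SmoothFun E M) L] [IsSectionModule E V L] (x : M) :
    ∃ l : V x →ₗ[ℝ] L, ∀ v, l v x = v := by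
  obtain ⟨n, s, θ, χ, h1, -, h⟩ := IsSectionModule.exists_frame (E := E) (V := V) (L := L) x
  refine ⟨∑ i, (θ i x).smulRight (s i), fun v => ?_⟩
  rw [LinearMap.sum_apply, coe_sum_section (E := E)]
  simp only [LinearMap.smulRight_apply, coe_const_smul_section (E := E)]
  rw [← h, h1, one_smul]

variable [IsSectionModule E V L]

/-- A field is determined by its values on sections. -/
theorem AlternatingField.ext_sections [IsScalarTower ℝ (SmoothFun E M) L]
    {P Q : AlternatingField E V L q}
    (h : ∀ (s : Fin q → L) (x : M), P x (fun i => s i x) = Q x (fun i => s i x)) : P = Q := by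
  ext x v
  obtain ⟨l, hl⟩ := exists_lift (E := E) (L := L) x
  simpa [hl] using h (fun i => l (v i)) x

/-- The `C^∞(M)`-multilinear map on sections given by a field. -/
def AlternatingField.onSections (P : AlternatingField E V L q) :
    L [⋀^Fin q]→ₗ[SmoothFun E M] SmoothFun E M where
  toFun s := ⟨_, P.smooth s⟩
  map_update_add' {_} s i a b := by
    ext x
    have h : ∀ c, (fun j => (Function.update s i c j) x) =
        Function.update (fun j => s j x) i (c x) := fun c => by
      ext j; by_cases hj : j = i
      · subst hj; simp
      · simp [hj]
    change P x (fun j => (Function.update s i (a + b) j) x) =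
      P x (fun j => (Function.update s i a j) x) + P x (fun j => (Function.update s i b j) x)
    rw [h, h, h, IsSectionModule.coe_add (E := E)]
    exact (P x).map_update_add (fun j => s j x) i (a x) (b x)
  map_update_smul' {_} s i f a := by
    ext x
    have h : ∀ c, (fun j => (Function.update s i c j) x) =
        Function.update (fun j => s j x) i (c x) := fun c => by
      ext j; by_cases hj : j = i
      · subst hj; simp
      · simp [hj]
    change P x (fun j => (Function.update s i (f • a) j) x) =
      f x * P x (fun j => (Function.update s i a j) x)
    rw [h, h, IsSectionModule.coe_smul (E := E)]
    exact (P x).map_update_smul (fun j => s j x) i (f x) (a x)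
  map_eq_zero_of_eq' s i j hs hij := by
    ext x
    exact (P x).map_eq_zero_of_eq _ (by simp [hs]) hij

@[simp] theorem AlternatingField.onSections_apply (P : AlternatingField E V L q) (s : Fin q → L)
    (x : M) : P.onSections s x = P x (fun i => s i x) := rfl

/-- A `C^∞(M)`-multilinear map on sections is pointwise. -/
theorem tensorial (T : L [⋀^Fin q]→ₗ[SmoothFun E M] SmoothFun E M) (x : M) {s t : Fin q → L}
    (hst : ∀ i, s i x = t i x) : T s x = T t x := by
  classical
  -- vanishing of one argument at `x` forces vanishing of the value at `x`
  have key : ∀ (u : Fin q → L) (i : Fin q) (a : L), a x = 0 → T (Function.update u i a) x = 0 := by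
    intro u i a ha
    obtain ⟨n, b, θ, χ, h1, hθ, h⟩ :=
      IsSectionModule.exists_frame (E := E) (V := V) (L := L) x
    let g : Fin n → SmoothFun E M := fun k => ⟨_, hθ k a⟩
    have ha' : χ • a = ∑ k, g k • b k := by
      refine DFunLike.ext _ _ fun y => ?_
      rw [IsSectionModule.coe_smul (E := E), coe_sum_section (E := E), h]
      simp only [IsSectionModule.coe_smul (E := E)]
      rfl
    have h2 := congrArg (fun c => T (Function.update u i c) x) ha'
    simp only [T.map_update_smul, T.map_update_sum] at h2
    have h3 : χ x * T (Function.update u i a) x = 0 := by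
      refine h2.trans ?_
      change evalFun x _ = 0
      rw [map_sum]
      refine Finset.sum_eq_zero fun k _ => ?_
      change θ k x (a x) * _ = 0
      rw [ha, map_zero, zero_mul]
    rwa [h1, one_mul] at h3
  have step : ∀ A : Finset (Fin q), T (A.piecewise s t) x = T t x := by
    intro A
    induction A using Finset.induction_on with
    | empty => simp
    | insert i A hi ih =>
      rw [← ih, Finset.piecewise_insert]
      have e : A.piecewise s t = Function.update (A.piecewise s t) i (t i) := by
        conv_lhs => rw [← Function.update_eq_self i (A.piecewise s t)]
        simp [hi]
      conv_rhs => rw [e]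
      have h4 := T.map_update_sub (A.piecewise s t) i (s i) (t i)
      have h5 := key (A.piecewise s t) i (s i - t i) (by
        change evalSection E x (s i - t i) = 0
        rw [map_sub]; change s i x - t i x = 0; rw [hst, sub_self])
      rw [h4] at h5
      exact sub_eq_zero.1 h5
  simpa using step Finset.univ

/-- A `C^∞(M)`-multilinear alternating map on sections is given by a unique field. -/
theorem existsUnique_field [IsScalarTower ℝ (SmoothFun E M) L]
    (T : L [⋀^Fin q]→ₗ[SmoothFun E M] SmoothFun E M) :
    ∃! P : AlternatingField E V L q, ∀ (s : Fin q → L) (x : M), P x (fun i => s i x) = T s x := by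
  choose l hl using fun x : M => exists_lift (E := E) (V := V) (L := L) x
  have key : ∀ (s : Fin q → L) (x : M), T (fun i => l x (s i x)) x = T s x := fun s x =>
    tensorial T x fun i => hl x _
  refine ⟨⟨fun x => ((evalFun x).compAlternatingMap
      (restrictAlternating T)).compLinearMap (l x), fun s => ?_⟩, fun s x => key s x, ?_⟩
  · exact (T s).contMDiff.congr fun x => key s x
  · intro P hP
    exact AlternatingField.ext_sections fun s x => (hP s x).trans (key s x).symm

end Sections


section Koszul

variable [AddCommGroup L] [Module ℝ L] [Module (SmoothFun E M) L]

variable (E M L) in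
/-- A skew-symmetric bracket on the module `L` of sections, together with an action of `L` on
`C^∞(M)` by derivations, satisfying the Leibniz rule. -/
structure AnchoredBracket where
  bracket : L →ₗ[ℝ] L →ₗ[ℝ] L
  anchor : L →ₗ[SmoothFun E M] Derivation ℝ (SmoothFun E M) (SmoothFun E M)
  bracket_self : ∀ s, bracket s s = 0
  bracket_smul : ∀ (s t : L) (f : SmoothFun E M),
    bracket s (f • t) = f • bracket s t + anchor s f • t

namespace AnchoredBracket

variable (B : AnchoredBracket E M L)

theorem bracket_swap (s t : L) : B.bracket s t = -B.bracket t s := by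
  have h := B.bracket_self (s + t)
  simp only [map_add, LinearMap.add_apply, B.bracket_self, zero_add, add_zero] at h
  exact eq_neg_of_add_eq_zero_right h

theorem smul_bracket (s t : L) (f : SmoothFun E M) :
    B.bracket (f • s) t = f • B.bracket s t - B.anchor t f • s := by
  rw [bracket_swap, bracket_smul, B.bracket_swap t s]
  simp only [smul_neg, neg_add, neg_neg, sub_eq_add_neg]

/-- The Koszul expression
`∑ i, (-1)^i s_i (Q (s_0, …, ŝ_i, …, s_q))`
`+ ∑ i < j, (-1)^(i+j) Q ([s_i, s_j], s_0, …, ŝ_i, …, ŝ_j, …, s_q)`.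
In the second sum, the pairs `i < j` of elements of `{0, …, m + 1}` are written as
`(i, j + 1)` with `i ≤ j` in `{0, …, m}`; this changes the sign. -/
def koszul : ∀ {q : ℕ}, (L [⋀^Fin q]→ₗ[SmoothFun E M] SmoothFun E M) →
    (Fin (q + 1) → L) → SmoothFun E M
  | 0, Q, s => B.anchor (s 0) (Q ![])
  | q + 1, Q, s =>
    (∑ i : Fin (q + 2), (-1 : ℤ) ^ (i : ℕ) • B.anchor (s i) (Q (i.removeNth s))) -
      ∑ i : Fin (q + 1), ∑ j ≥ i, (-1 : ℤ) ^ (i + j : ℕ) •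
        Q (Matrix.vecCons (B.bracket (s i.castSucc) (s j.succ))
          (j.removeNth (i.castSucc.removeNth s)))

variable [IsScalarTower ℝ (SmoothFun E M) L]

theorem koszul_add (P Q : L [⋀^Fin q]→ₗ[SmoothFun E M] SmoothFun E M) (s : Fin (q + 1) → L) :
    B.koszul (P + Q) s = B.koszul P s + B.koszul Q s := by
  cases q with
  | zero => simp [koszul]
  | succ q =>
    simp only [koszul, AlternatingMap.add_apply, map_add, smul_add, Finset.sum_add_distrib]
    ring

theorem koszul_smul (f : SmoothFun E M) (Q : L [⋀^Fin q]→ₗ[SmoothFun E M] SmoothFun E M)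
    (s : Fin (q + 1) → L) (hf : ∀ i, B.anchor (s i) f = 0) :
    B.koszul (f • Q) s = f * B.koszul Q s := by
  cases q with
  | zero => simp [koszul, Derivation.leibniz, hf]
  | succ q =>
    simp only [koszul, AlternatingMap.smul_apply, smul_eq_mul, Derivation.leibniz, hf, mul_zero,
      add_zero, mul_sub, Finset.mul_sum, mul_smul_comm]

/-- First part of the Koszul expression, before alternatization. -/
def koszulAux₁ (Q : L [⋀^Fin q]→ₗ[SmoothFun E M] SmoothFun E M) :
    L →ₗ[ℝ] L [⋀^Fin q]→ₗ[ℝ] SmoothFun E M where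
  toFun s := ((B.anchor s : Derivation ℝ (SmoothFun E M) (SmoothFun E M)) :
    SmoothFun E M →ₗ[ℝ] SmoothFun E M).compAlternatingMap (restrictAlternating Q)
  map_add' s t := by ext u : 1; simp
  map_smul' c s := by
    ext u : 1
    rw [← one_smul (SmoothFun E M) s, ← smul_assoc, map_smul]
    simp

/-- Second part of the Koszul expression, before alternatization. -/
def koszulAux₂ (Q : L [⋀^Fin (q + 1)]→ₗ[SmoothFun E M] SmoothFun E M) :
    L →ₗ[ℝ] L →ₗ[ℝ] L [⋀^Fin q]→ₗ[ℝ] SmoothFun E M :=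
  B.bracket.compr₂ (restrictAlternating Q).curryLeft

theorem removeNth_succ_cons {α : Type*} {n : ℕ} (i : Fin (n + 1)) (a : α) (v : Fin (n + 1) → α) :
    i.succ.removeNth (Matrix.vecCons a v) = Matrix.vecCons a (i.removeNth v) := by
  ext k
  refine Fin.cases ?_ (fun k => ?_) k <;> simp [Fin.removeNth]

theorem removeNth_zero_cons {α : Type*} {n : ℕ} (a : α) (v : Fin n → α) :
    (0 : Fin (n + 1)).removeNth (Matrix.vecCons a v) = v := by
  ext k
  simp [Fin.removeNth]

/-- The Koszul expression is `ℝ`-multilinear and alternating. -/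
def koszulReal : ∀ {q : ℕ}, (L [⋀^Fin q]→ₗ[SmoothFun E M] SmoothFun E M) →
    L [⋀^Fin (q + 1)]→ₗ[ℝ] SmoothFun E M
  | 0, Q => AlternatingMap.alternatizeUncurryFin (B.koszulAux₁ Q)
  | _ + 1, Q => AlternatingMap.alternatizeUncurryFin (B.koszulAux₁ Q) -
      (2⁻¹ : ℝ) • AlternatingMap.alternatizeUncurryFin
        (AlternatingMap.alternatizeUncurryFinLM ∘ₗ B.koszulAux₂ Q)

theorem koszulReal_apply (Q : L [⋀^Fin q]→ₗ[SmoothFun E M] SmoothFun E M) (s : Fin (q + 1) → L) :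
    B.koszulReal Q s = B.koszul Q s := by
  cases q with
  | zero =>
    simp only [koszulReal, koszul, AlternatingMap.alternatizeUncurryFin_apply]
    simp [koszulAux₁, Subsingleton.elim (Fin.removeNth 0 s) ![]]
  | succ q =>
    simp only [koszulReal, koszul, AlternatingMap.sub_apply, AlternatingMap.smul_apply,
      AlternatingMap.alternatizeUncurryFin_alternatizeUncurryFinLM_comp_apply]
    congr 1
    · simp only [AlternatingMap.alternatizeUncurryFin_apply]
      rfl
    · rw [Finset.smul_sum]
      refine Finset.sum_congr rfl fun i _ => ?_
      rw [Finset.smul_sum]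
      refine Finset.sum_congr rfl fun j _ => ?_
      rw [smul_comm]
      congr 1
      have h : B.koszulAux₂ Q (s j.succ) (s i.castSucc) =
          -B.koszulAux₂ Q (s i.castSucc) (s j.succ) := by
        simp only [koszulAux₂, LinearMap.compr₂_apply]
        rw [B.bracket_swap, map_neg]
      rw [h]
      simp only [AlternatingMap.neg_apply, sub_neg_eq_add, ← two_smul ℝ, smul_smul]
      norm_num
      rfl

theorem alternatizeUncurryFin_cons {n : ℕ} (F : L →ₗ[ℝ] L [⋀^Fin (n + 1)]→ₗ[ℝ] SmoothFun E M)
    (a : L) (v : Fin (n + 1) → L) :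
    AlternatingMap.alternatizeUncurryFin F (Matrix.vecCons a v) =
      F a v - ∑ i : Fin (n + 1), (-1 : ℤ) ^ (i : ℕ) •
        F (v i) (Matrix.vecCons a (i.removeNth v)) := by
  rw [AlternatingMap.alternatizeUncurryFin_apply, Fin.sum_univ_succ]
  simp only [removeNth_succ_cons, removeNth_zero_cons, sub_eq_add_neg]
  congr 1
  · simp
  · rw [← Finset.sum_neg_distrib]
    refine Finset.sum_congr rfl fun i _ => ?_
    simp [pow_succ]

theorem alternatizeUncurryFin_cons_zero (F : L →ₗ[ℝ] L [⋀^Fin 0]→ₗ[ℝ] SmoothFun E M)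
    (a : L) (v : Fin 0 → L) :
    AlternatingMap.alternatizeUncurryFin F (Matrix.vecCons a v) = F a v := by
  rw [AlternatingMap.alternatizeUncurryFin_apply]
  simp

theorem map_vecCons_smul (Q : L [⋀^Fin (q + 1)]→ₗ[SmoothFun E M] SmoothFun E M)
    (f : SmoothFun E M) (a : L) (v : Fin q → L) :
    Q (Matrix.vecCons (f • a) v) = f * Q (Matrix.vecCons a v) :=
  Q.toMultilinearMap.cons_smul v f a

theorem koszulAux₁_apply (Q : L [⋀^Fin q]→ₗ[SmoothFun E M] SmoothFun E M) (s : L)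
    (v : Fin q → L) : B.koszulAux₁ Q s v = B.anchor s (Q v) := rfl

theorem koszulAux₂_apply (Q : L [⋀^Fin (q + 1)]→ₗ[SmoothFun E M] SmoothFun E M) (s t : L)
    (v : Fin q → L) : B.koszulAux₂ Q s t v = Q (Matrix.vecCons (B.bracket s t) v) := rfl

theorem koszulAux₁_smul (Q : L [⋀^Fin (q + 1)]→ₗ[SmoothFun E M] SmoothFun E M)
    (f : SmoothFun E M) (a : L) (v : Fin (q + 1) → L) :
    AlternatingMap.alternatizeUncurryFin (B.koszulAux₁ Q) (Matrix.vecCons (f • a) v) =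
      f * AlternatingMap.alternatizeUncurryFin (B.koszulAux₁ Q) (Matrix.vecCons a v) -
      ∑ i : Fin (q + 1), (-1 : ℤ) ^ (i : ℕ) •
        (Q (Matrix.vecCons a (i.removeNth v)) * B.anchor (v i) f) := by
  simp only [alternatizeUncurryFin_cons, koszulAux₁_apply, map_vecCons_smul, map_smul,
    Derivation.leibniz, Derivation.smul_apply, smul_add, smul_eq_mul, Finset.sum_add_distrib,
    mul_sub, Finset.mul_sum, mul_smul_comm]
  ring

theorem koszulAux₂_smul_right (Q : L [⋀^Fin (q + 1)]→ₗ[SmoothFun E M] SmoothFun E M)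
    (f : SmoothFun E M) (a b : L) (v : Fin q → L) :
    AlternatingMap.alternatizeUncurryFin (B.koszulAux₂ Q b) (Matrix.vecCons (f • a) v) =
      f * AlternatingMap.alternatizeUncurryFin (B.koszulAux₂ Q b) (Matrix.vecCons a v) +
        Q (Matrix.vecCons a v) * B.anchor b f := by
  have h : Q (Matrix.vecCons (B.bracket b (f • a)) v) =
      f * Q (Matrix.vecCons (B.bracket b a) v) + Q (Matrix.vecCons a v) * B.anchor b f := by
    rw [B.bracket_smul]
    have h1 := Q.toMultilinearMap.cons_add v (f • B.bracket b a) (B.anchor b f • a)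
    refine h1.trans ?_
    have h2 := map_vecCons_smul Q f (B.bracket b a) v
    have h3 := map_vecCons_smul Q (B.anchor b f) a v
    exact congrArg₂ (· + ·) h2 (h3.trans (mul_comm _ _))
  cases q with
  | zero => simp only [alternatizeUncurryFin_cons_zero, koszulAux₂_apply, h]
  | succ q =>
    have h' : ∀ (c : L) (w : Fin q → L),
        Q (Matrix.vecCons c (Matrix.vecCons (f • a) w)) =
          f * Q (Matrix.vecCons c (Matrix.vecCons a w)) := fun c w => by
      have e : ∀ d, Matrix.vecCons c (Matrix.vecCons d w) =
          Function.update (Matrix.vecCons c (Matrix.vecCons a w)) 1 d := fun d => by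
        ext i
        refine Fin.cases ?_ (fun i => Fin.cases ?_ (fun i => ?_) i) i <;>
          simp [Function.update, Fin.ext_iff]
      rw [e (f • a), Q.map_update_smul, ← e a, smul_eq_mul]
    simp only [alternatizeUncurryFin_cons, koszulAux₂_apply, h, h', mul_sub, Finset.mul_sum,
      mul_smul_comm]
    ring

theorem koszulAux₂_smul (Q : L [⋀^Fin (q + 1)]→ₗ[SmoothFun E M] SmoothFun E M)
    (f : SmoothFun E M) (a : L) (v : Fin (q + 1) → L) :
    AlternatingMap.alternatizeUncurryFin
        (AlternatingMap.alternatizeUncurryFinLM ∘ₗ B.koszulAux₂ Q) (Matrix.vecCons (f • a) v) =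
      f * AlternatingMap.alternatizeUncurryFin
        (AlternatingMap.alternatizeUncurryFinLM ∘ₗ B.koszulAux₂ Q) (Matrix.vecCons a v) -
      (2 : ℝ) • ∑ i : Fin (q + 1), (-1 : ℤ) ^ (i : ℕ) •
        (Q (Matrix.vecCons a (i.removeNth v)) * B.anchor (v i) f) := by
  have h : AlternatingMap.alternatizeUncurryFin (B.koszulAux₂ Q (f • a)) v =
      f * AlternatingMap.alternatizeUncurryFin (B.koszulAux₂ Q a) v -
        ∑ i : Fin (q + 1), (-1 : ℤ) ^ (i : ℕ) •
          (Q (Matrix.vecCons a (i.removeNth v)) * B.anchor (v i) f) := by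
    simp only [AlternatingMap.alternatizeUncurryFin_apply, koszulAux₂_apply, Finset.mul_sum,
      ← Finset.sum_sub_distrib]
    refine Finset.sum_congr rfl fun i _ => ?_
    rw [B.smul_bracket, sub_eq_add_neg, ← neg_smul]
    have h1 := Q.toMultilinearMap.cons_add (i.removeNth v) (f • B.bracket a (v i))
      ((-B.anchor (v i) f) • a)
    have h2 := map_vecCons_smul Q f (B.bracket a (v i)) (i.removeNth v)
    have h3 := map_vecCons_smul Q (-B.anchor (v i) f) a (i.removeNth v)
    have h4 : Q (Matrix.vecCons (f • B.bracket a (v i) + (-B.anchor (v i) f) • a)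
        (i.removeNth v)) = f * Q (Matrix.vecCons (B.bracket a (v i)) (i.removeNth v)) +
        -B.anchor (v i) f * Q (Matrix.vecCons a (i.removeNth v)) :=
      h1.trans (congrArg₂ (· + ·) h2 h3)
    rw [h4, smul_add, mul_smul_comm, neg_mul, smul_neg, mul_comm (B.anchor (v i) f),
      sub_eq_add_neg]
  simp only [alternatizeUncurryFin_cons, LinearMap.comp_apply,
    AlternatingMap.alternatizeUncurryFinLM_apply, h, B.koszulAux₂_smul_right, smul_add,
    Finset.sum_add_distrib, mul_sub, Finset.mul_sum, mul_smul_comm, two_smul]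
  ring

theorem koszulReal_cons_smul (Q : L [⋀^Fin q]→ₗ[SmoothFun E M] SmoothFun E M)
    (f : SmoothFun E M) (a : L) (v : Fin q → L) :
    B.koszulReal Q (Matrix.vecCons (f • a) v) = f * B.koszulReal Q (Matrix.vecCons a v) := by
  cases q with
  | zero =>
    simp only [koszulReal, alternatizeUncurryFin_cons_zero, koszulAux₁_apply, map_smul,
      Derivation.smul_apply, smul_eq_mul]
  | succ q =>
    simp only [koszulReal, AlternatingMap.sub_apply, AlternatingMap.smul_apply, koszulAux₁_smul,
      koszulAux₂_smul, smul_sub, smul_smul, mul_sub, mul_smul_comm]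
    norm_num

/-- The Koszul expression is `C^∞(M)`-multilinear and alternating. -/
def koszulMap (Q : L [⋀^Fin q]→ₗ[SmoothFun E M] SmoothFun E M) :
    L [⋀^Fin (q + 1)]→ₗ[SmoothFun E M] SmoothFun E M where
  toFun := B.koszul Q
  map_update_add' s i a b := by
    simp only [← koszulReal_apply]; exact (B.koszulReal Q).map_update_add' s i a b
  map_update_smul' {_} s i f a := by
    simp only [← koszulReal_apply, smul_eq_mul]
    have h0 : ∀ (u : Fin (q + 1) → L) (c : L), B.koszulReal Q (Function.update u 0 (f • c)) =
        f * B.koszulReal Q (Function.update u 0 c) := fun u c => by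
      have h : ∀ d, Function.update u 0 d = Matrix.vecCons d (fun j => u j.succ) := fun d => by
        ext j; refine Fin.cases ?_ (fun j => ?_) j <;> simp [Function.update]
      rw [h, h, koszulReal_cons_smul]
    by_cases hi : i = 0
    · subst hi
      convert h0 s a
    · have h : ∀ d, Function.update s i d ∘ Equiv.swap i 0 =
          Function.update (s ∘ Equiv.swap i 0) 0 d := fun d => by
        ext j
        by_cases hj : j = 0
        · subst hj; simp
        · by_cases hj' : j = i
          · subst hj'; simp [hj, Ne.symm hj]
          · simp [hj, hj', Equiv.swap_apply_of_ne_of_ne]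
      have h' : ∀ d, B.koszulReal Q (Function.update s i d) =
          -B.koszulReal Q (Function.update (s ∘ Equiv.swap i 0) 0 d) := fun d => by
        rw [← h, AlternatingMap.map_swap _ _ hi, neg_neg]
      have e : ∀ d, (@Function.update _ _ (fun a b => ‹DecidableEq (Fin (q + 1))› a b) s i d) =
        Function.update s i d := fun d => by congr
      convert_to B.koszulReal Q (Function.update s i (f • a)) =
        f * B.koszulReal Q (Function.update s i a)
      rw [h', h', h0, mul_neg]
  map_eq_zero_of_eq' s i j h hij := by
    rw [← koszulReal_apply]; exact (B.koszulReal Q).map_eq_zero_of_eq s h hij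

/-- There is a unique field whose values on sections are given by the Koszul expression. -/
theorem existsUnique_koszul [IsSectionModule E V L] (P : AlternatingField E V L q) :
    ∃! R : AlternatingField E V L (q + 1), ∀ (s : Fin (q + 1) → L) (x : M),
      R x (fun i => s i x) = B.koszul P.onSections s x :=
  existsUnique_field (B.koszulMap P.onSections)

end AnchoredBracket

end Koszul

end AlternatingFields

section Instances

variable {E : Type*} [NormedAddCommGroup E] [NormedSpace ℝ E] [FiniteDimensional ℝ E]
  {M : Type*} [TopologicalSpace M] [ChartedSpace E M] [IsManifold 𝓘(ℝ, E) ∞ M] [T2Space M]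

instance (x : M) : FiniteDimensional ℝ (TangentSpace 𝓘(ℝ, E) x) :=
  inferInstanceAs (FiniteDimensional ℝ E)

instance : IsSectionModule E (TangentSpace 𝓘(ℝ, E) : M → Type _) (VectorFields E M) where
  coe_add _ _ _ := rfl
  coe_smul _ _ _ := rfl
  exists_frame x₀ := by
    obtain ⟨n, s, θ, χ, h1, h⟩ := exists_frame (E := E) x₀
    exact ⟨n, s, fun i => θ i, χ, h1.self_of_nhds, fun i => (θ i).smooth, h⟩

instance : IsSectionModule E (CotangentSpace E M) (OneForms E M) where
  coe_add _ _ _ := rfl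
  coe_smul _ _ _ := rfl
  exists_frame x₀ := by
    obtain ⟨n, s, θ, χ, h1, h⟩ := exists_frame (E := E) x₀
    refine ⟨n, θ, fun i x => Module.Dual.eval ℝ _ (s i x), χ, h1.self_of_nhds,
      fun i α => α.smooth (s i), fun x a => ?_⟩
    ext v
    have := congrArg a (h x v)
    simp only [map_smul, map_sum, smul_eq_mul] at this
    simp only [LinearMap.smul_apply, smul_eq_mul, this, LinearMap.sum_apply,
      Module.Dual.eval_apply]
    exact Finset.sum_congr rfl fun i _ => mul_comm _ _

theorem OneForms.ext_pair {α β : OneForms E M} (h : ∀ X, OneForms.pair α X = OneForms.pair β X) :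
    α = β := by
  ext x v
  obtain ⟨l, hl⟩ := exists_lift (E := E) (V := (TangentSpace 𝓘(ℝ, E) : M → Type _))
    (L := VectorFields E M) x
  have := DFunLike.congr_fun (h (l v)) x
  simpa [hl] using this

/-- A `C^∞(M)`-linear map from vector fields to functions is given by a unique 1-form. -/
theorem OneForms.existsUnique (T : VectorFields E M →ₗ[SmoothFun E M] SmoothFun E M) :
    ∃! α : OneForms E M, ∀ (X : VectorFields E M) (x : M), α x (X x) = T X x := by
  have huniq : ∀ α β : OneForms E M, (∀ (X : VectorFields E M) (x : M), α x (X x) = T X x) →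
      (∀ (X : VectorFields E M) (x : M), β x (X x) = T X x) → α = β := fun α β hα hβ =>
    OneForms.ext_pair fun X => by ext x; exact (hα X x).trans (hβ X x).symm
  obtain ⟨P, hP, -⟩ := existsUnique_field (E := E)
    (V := (TangentSpace 𝓘(ℝ, E) : M → Type _)) (L := VectorFields E M)
    (AlternatingMap.ofSubsingleton (SmoothFun E M) (VectorFields E M) (SmoothFun E M)
      (0 : Fin 1) T)
  let α : OneForms E M := ⟨fun x => (AlternatingMap.ofSubsingleton ℝ _ ℝ (0 : Fin 1)).symm (P x),
    fun X => P.smooth fun _ => X⟩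
  have hα : ∀ (X : VectorFields E M) (x : M), α x (X x) = T X x := fun X x => hP (fun _ => X) x
  exact ⟨α, hα, fun β hβ => huniq β α hβ hα⟩

/-- A family of tangent vectors on which all 1-forms are smooth is a smooth vector field. -/
theorem contMDiff_of_oneForms (v : ∀ x : M, TangentSpace 𝓘(ℝ, E) x)
    (hv : ∀ α : OneForms E M, ContMDiff 𝓘(ℝ, E) 𝓘(ℝ, ℝ) ∞ (fun x => α x (v x))) :
    ContMDiff 𝓘(ℝ, E) (𝓘(ℝ, E).prod 𝓘(ℝ, E)) ∞ (fun x => TotalSpace.mk' E x (v x)) := by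
  intro x₀
  obtain ⟨n, s, θ, χ, h1, h⟩ := exists_frame (E := E) x₀
  let X : VectorFields E M :=
    ∑ i, (show SmoothFun E M from ⟨fun x => θ i x (v x), hv (θ i)⟩) • s i
  refine (X.contMDiff x₀).congr_of_eventuallyEq ?_
  filter_upwards [h1] with y hy
  have : X y = v y := by
    have h2 := h y (v y)
    rw [hy, one_smul] at h2
    rw [h2]
    exact coe_sum_section (E := E) (V := (TangentSpace 𝓘(ℝ, E) : M → Type _)) _ _ y
  rw [this]

end Instances

section Operators

variable (E : Type*) [NormedAddCommGroup E] [NormedSpace ℝ E] [FiniteDimensional ℝ E]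
  (M : Type*) [TopologicalSpace M] [ChartedSpace E M] [IsManifold 𝓘(ℝ, E) ∞ M] [T2Space M]

/-- The space `Ω^q(M)` of smooth differential `q`-forms. -/
abbrev Forms (q : ℕ) : Type _ :=
  AlternatingField E (TangentSpace 𝓘(ℝ, E) : M → Type _) (VectorFields E M) q

/-- The space `𝒱^q(M)` of smooth skew-symmetric contravariant `q`-tensor fields. -/
abbrev Multivectors (q : ℕ) : Type _ :=
  AlternatingField E (CotangentSpace E M) (OneForms E M) q

/-- The Lie bracket of vector fields and their action on functions. -/
def tangentBracket : AnchoredBracket E M (VectorFields E M) :=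
  haveI : CompleteSpace E := FiniteDimensional.complete ℝ E
  { bracket := VectorFields.lie
    anchor := VectorFields.derivation
    bracket_self := VectorFields.lie_self
    bracket_smul := VectorFields.lie_smul }

variable {E M}

/-- The exterior derivative: `d η` is the unique form such that
`dη(X_0,…,X_q) = ∑ (-1)^i X_i(η(…,X̂_i,…)) + ∑_{i<j} (-1)^(i+j) η([X_i,X_j],…,X̂_i,…,X̂_j,…)`
for all vector fields `X_0, …, X_q`. -/
def Forms.d {q : ℕ} (η : Forms E M q) : Forms E M (q + 1) :=
  ((tangentBracket E M).existsUnique_koszul η).choose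

theorem Forms.d_apply {q : ℕ} (η : Forms E M q) (X : Fin (q + 1) → VectorFields E M) (x : M) :
    η.d x (fun i => X i x) = (tangentBracket E M).koszul η.onSections X x :=
  ((tangentBracket E M).existsUnique_koszul η).choose_spec.1 X x

/-- The Lie derivative `L_X β` of a 1-form as a linear map on vector fields. -/
def lieDerivAux (X : VectorFields E M) (β : OneForms E M) :
    VectorFields E M →ₗ[SmoothFun E M] SmoothFun E M where
  toFun Y := (tangentBracket E M).anchor X (OneForms.pair β Y) -
    OneForms.pair β ((tangentBracket E M).bracket X Y)
  map_add' Y Z := by simp only [map_add]; ring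
  map_smul' f Y := by
    simp only [map_smul, smul_eq_mul, Derivation.leibniz, AnchoredBracket.bracket_smul, map_add,
      RingHom.id_apply]
    ring

/-- The Lie derivative of a 1-form: `(L_X β)(Y) = X(β(Y)) - β([X, Y])`. -/
def lieDeriv (X : VectorFields E M) (β : OneForms E M) : OneForms E M :=
  (OneForms.existsUnique (lieDerivAux X β)).choose

theorem pair_lieDeriv (X Y : VectorFields E M) (β : OneForms E M) :
    OneForms.pair (lieDeriv X β) Y = (tangentBracket E M).anchor X (OneForms.pair β Y) -
      OneForms.pair β ((tangentBracket E M).bracket X Y) := by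
  ext x
  exact (OneForms.existsUnique (lieDerivAux X β)).choose_spec.1 Y x

variable (E M) in
/-- A Poisson bracket on `C^∞(M)`. -/
structure PoissonBracket where
  bracket : SmoothFun E M →ₗ[ℝ] SmoothFun E M →ₗ[ℝ] SmoothFun E M
  skew : ∀ f g, bracket f g = -bracket g f
  leibniz : ∀ f g h, bracket f (g * h) = bracket f g * h + g * bracket f h
  jacobi : ∀ f g h,
    bracket (bracket f g) h + bracket (bracket g h) f + bracket (bracket h f) g = 0

/-- `Λ` is the Poisson bivector of the bracket: `{f, g} = Λ(df, dg)`. -/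
def PoissonBracket.IsBivector (B : PoissonBracket E M) (Λ : Multivectors E M 2) : Prop :=
  ∀ (f g : SmoothFun E M) (x : M), B.bracket f g x = Λ x ![OneForms.d f x, OneForms.d g x]

namespace Multivectors

variable (Λ : Multivectors E M 2)

theorem update_vec_two {α : Type*} (a b c : α) : Function.update ![a, b] 1 c = ![a, c] := by
  ext i : 1
  fin_cases i <;> simp

/-- The function `Λ(α, β)`. -/
def contract : OneForms E M →ₗ[SmoothFun E M] OneForms E M →ₗ[SmoothFun E M] SmoothFun E M :=
  LinearMap.mk₂ _ (fun α β => Λ.onSections ![α, β])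
    (fun α β γ => Λ.onSections.toMultilinearMap.cons_add ![γ] α β)
    (fun f α β => Λ.onSections.toMultilinearMap.cons_smul ![β] f α)
    (fun α β γ => by
      have := Λ.onSections.map_update_add ![α, 0] 1 β γ
      rwa [update_vec_two, update_vec_two, update_vec_two] at this)
    (fun f α β => by
      have := Λ.onSections.map_update_smul ![α, 0] 1 f β
      rwa [update_vec_two, update_vec_two] at this)

/-- The bundle map `♯ : T*M → TM`, where `β(α^♯) = Λ(α, β)` for `α, β ∈ T*_x M`. -/
def sharp (x : M) : CotangentSpace E M x →ₗ[ℝ] TangentSpace 𝓘(ℝ, E) x :=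
  (Module.evalEquiv ℝ (TangentSpace 𝓘(ℝ, E) x)).symm.toLinearMap ∘ₗ
    LinearMap.mk₂ ℝ (fun a b => Λ x ![a, b])
    (fun a b c => (Λ x).toMultilinearMap.cons_add ![c] a b)
    (fun c a b => (Λ x).toMultilinearMap.cons_smul ![b] c a)
    (fun a b c => by
      have := (Λ x).map_update_add ![a, 0] 1 b c
      rwa [update_vec_two, update_vec_two, update_vec_two] at this)
    (fun c a b => by
      have := (Λ x).map_update_smul ![a, 0] 1 c b
      rwa [update_vec_two, update_vec_two] at this)

theorem apply_sharp (x : M) (a b : CotangentSpace E M x) : b (Λ.sharp x a) = Λ x ![a, b] := by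
  simp only [sharp, LinearMap.comp_apply, LinearEquiv.coe_coe]
  rw [Module.apply_evalEquiv_symm_apply]
  rfl

/-- The vector field `α^♯` of a 1-form `α`. -/
def sharpField : OneForms E M →ₗ[SmoothFun E M] VectorFields E M where
  toFun α := ⟨fun x => Λ.sharp x (α x), contMDiff_of_oneForms _ fun β =>
    (Λ.contract α β).contMDiff.congr fun x => by
      rw [apply_sharp]
      change _ = Λ x (fun i => (![α, β] : Fin 2 → OneForms E M) i x)
      congr 1
      ext i : 1
      fin_cases i <;> rfl⟩
  map_add' α β := by ext x; exact map_add (Λ.sharp x) (α x) (β x)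
  map_smul' f α := by ext x; exact map_smul (Λ.sharp x) (f x) (α x)

@[simp] theorem sharpField_apply (α : OneForms E M) (x : M) :
    Λ.sharpField α x = Λ.sharp x (α x) := rfl

/-- The bracket of 1-forms `{α, β} = L_{α^♯} β - L_{β^♯} α - d(Λ(α, β))`. -/
def formBracket (α β : OneForms E M) : OneForms E M :=
  lieDeriv (Λ.sharpField α) β - lieDeriv (Λ.sharpField β) α - OneForms.d (Λ.contract α β)

theorem pair_sharpField (α β : OneForms E M) :
    OneForms.pair β (Λ.sharpField α) = Λ.contract α β := by
  ext x
  change β x (Λ.sharp x (α x)) = Λ x (fun i => (![α, β] : Fin 2 → OneForms E M) i x)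
  rw [apply_sharp]
  congr 1
  ext i : 1
  fin_cases i <;> rfl

theorem contract_self (α : OneForms E M) : Λ.contract α α = 0 :=
  Λ.onSections.map_eq_zero_of_eq ![α, α] (i := 0) (j := 1) rfl (by simp)

theorem pair_d (f : SmoothFun E M) (X : VectorFields E M) :
    OneForms.pair (OneForms.d f) X = (tangentBracket E M).anchor X f := rfl

theorem pair_formBracket (α β : OneForms E M) (X : VectorFields E M) :
    OneForms.pair (Λ.formBracket α β) X =
      ((tangentBracket E M).anchor (Λ.sharpField α) (OneForms.pair β X) -
        OneForms.pair β ((tangentBracket E M).bracket (Λ.sharpField α) X)) -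
      ((tangentBracket E M).anchor (Λ.sharpField β) (OneForms.pair α X) -
        OneForms.pair α ((tangentBracket E M).bracket (Λ.sharpField β) X)) -
      (tangentBracket E M).anchor X (Λ.contract α β) := by
  rw [← pair_lieDeriv, ← pair_lieDeriv, ← pair_d, formBracket]
  simp only [map_sub, LinearMap.sub_apply]

theorem contract_swap (α β : OneForms E M) : Λ.contract α β = -Λ.contract β α := by
  have h := Λ.contract_self (α + β)
  simp only [map_add, LinearMap.add_apply, contract_self, zero_add, add_zero] at h
  exact eq_neg_of_add_eq_zero_right h

theorem formBracket_swap (α β : OneForms E M) : Λ.formBracket α β = -Λ.formBracket β α :=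
  OneForms.ext_pair fun X => by
    rw [map_neg, LinearMap.neg_apply, pair_formBracket, pair_formBracket, Λ.contract_swap α β,
      map_neg]
    ring

theorem formBracket_add (α β γ : OneForms E M) :
    Λ.formBracket α (β + γ) = Λ.formBracket α β + Λ.formBracket α γ :=
  OneForms.ext_pair fun X => by
    simp only [pair_formBracket, map_add, LinearMap.add_apply, Derivation.add_apply]
    ring

theorem formBracket_smul (α β : OneForms E M) (f : SmoothFun E M) :
    Λ.formBracket α (f • β) =
      f • Λ.formBracket α β + (tangentBracket E M).anchor (Λ.sharpField α) f • β :=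
  OneForms.ext_pair fun X => by
    simp only [pair_formBracket, map_add, LinearMap.add_apply, map_smul,
      LinearMap.smul_apply, smul_eq_mul, Derivation.leibniz, Derivation.smul_apply,
      AnchoredBracket.smul_bracket, map_sub, pair_sharpField]
    rw [Λ.contract_swap β α]
    ring

theorem formBracket_const_smul (α β : OneForms E M) (c : ℝ) :
    Λ.formBracket α (c • β) = c • Λ.formBracket α β := by
  have h := Λ.formBracket_smul α β (algebraMap ℝ (SmoothFun E M) c)
  rwa [Derivation.map_algebraMap, zero_smul, add_zero] at h

/-- The bracket of 1-forms induced by `Λ`, and the action `(α, f) ↦ α^♯ f` on functions. -/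
def cotangentBracket : AnchoredBracket E M (OneForms E M) where
  bracket := LinearMap.mk₂ ℝ Λ.formBracket
    (fun α β γ => by
      rw [formBracket_swap, formBracket_add, neg_add, ← formBracket_swap, ← formBracket_swap])
    (fun c α β => by
      rw [formBracket_swap, formBracket_const_smul, ← smul_neg, ← formBracket_swap])
    Λ.formBracket_add
    (fun c α β => Λ.formBracket_const_smul α β c)
  anchor := (tangentBracket E M).anchor ∘ₗ Λ.sharpField
  bracket_self α := OneForms.ext_pair fun X => by
    simp [pair_formBracket, contract_self]
  bracket_smul := Λ.formBracket_smul

/-- The Lichnerowicz–Poisson coboundary `σ = [Λ, ·]` (Schouten bracket with `Λ`): `σ Q` is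
the unique multivector field with
`σQ(α_0,…,α_q) = ∑ (-1)^i α_i^♯(Q(…,α̂_i,…)) + ∑_{i<j} (-1)^(i+j) Q({α_i,α_j},…,α̂_i,…,α̂_j,…)`
for all 1-forms `α_0, …, α_q`. -/
def sigma {q : ℕ} (Q : Multivectors E M q) : Multivectors E M (q + 1) :=
  (Λ.cotangentBracket.existsUnique_koszul Q).choose

theorem sigma_apply {q : ℕ} (Q : Multivectors E M q) (α : Fin (q + 1) → OneForms E M) (x : M) :
    Λ.sigma Q x (fun i => α i x) = Λ.cotangentBracket.koszul Q.onSections α x :=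
  (Λ.cotangentBracket.existsUnique_koszul Q).choose_spec.1 α x

/-- On exact 1-forms the bracket is the Poisson bracket: `{df, dg} = d(Λ(df, dg))`. -/
theorem formBracket_d (f g : SmoothFun E M) :
    Λ.formBracket (OneForms.d f) (OneForms.d g) =
      OneForms.d (Λ.contract (OneForms.d f) (OneForms.d g)) := by
  have : CompleteSpace E := FiniteDimensional.complete ℝ E
  have hcomm : ∀ (X Y : VectorFields E M) (h : SmoothFun E M),
      OneForms.pair (OneForms.d h) ((tangentBracket E M).bracket X Y) =
        (tangentBracket E M).anchor X ((tangentBracket E M).anchor Y h) -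
          (tangentBracket E M).anchor Y ((tangentBracket E M).anchor X h) := fun X Y h =>
    VectorFields.derivation_lie X Y h
  refine OneForms.ext_pair fun X => ?_
  rw [pair_formBracket, hcomm, hcomm, pair_d, pair_d, pair_d, ← pair_d g (Λ.sharpField _),
    ← pair_d f (Λ.sharpField _), pair_sharpField, pair_sharpField,
    Λ.contract_swap (OneForms.d g), map_neg]
  ring

/-- On exact 1-forms, `σ Q` is the bracket of `Λ` and `Q` as multiderivations of `C^∞(M)`, i.e.
their Schouten bracket: with `{f, g} = Λ(df, dg)`, the value `σQ(df_0,…,df_q)` is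
`∑ (-1)^i {f_i, Q(…,d̂f_i,…)} + ∑_{i<j} (-1)^(i+j) Q(d{f_i,f_j},…,d̂f_i,…,d̂f_j,…)`. -/
theorem sigma_exact {q : ℕ} (Q : Multivectors E M (q + 1)) (f : Fin (q + 2) → SmoothFun E M) :
    (Λ.sigma Q).onSections (fun i => OneForms.d (f i)) =
    (∑ i : Fin (q + 2), (-1 : ℤ) ^ (i : ℕ) • Λ.contract (OneForms.d (f i))
        (OneForms.d (Q.onSections (i.removeNth fun k => OneForms.d (f k))))) -
      ∑ i : Fin (q + 1), ∑ j ≥ i, (-1 : ℤ) ^ (i + j : ℕ) •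
        Q.onSections (Matrix.vecCons
          (OneForms.d (Λ.contract (OneForms.d (f i.castSucc)) (OneForms.d (f j.succ))))
          (j.removeNth (i.castSucc.removeNth fun k => OneForms.d (f k)))) := by
  ext x
  rw [AlternatingField.onSections_apply, sigma_apply]
  refine DFunLike.congr_fun ?_ x
  rw [AnchoredBracket.koszul]
  congr 1
  · refine Finset.sum_congr rfl fun i _ => ?_
    rw [← pair_sharpField, pair_d]
    rfl
  · refine Finset.sum_congr rfl fun i _ => Finset.sum_congr rfl fun j _ => ?_
    rw [← formBracket_d]
    rfl

/-- The coboundary of a function: `σf = [Λ, f]` is `α ↦ Λ(α, df)`. -/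
theorem sigma_function (h : Multivectors E M 0) (α : Fin 1 → OneForms E M) :
    (Λ.sigma h).onSections α = Λ.contract (α 0) (OneForms.d (h.onSections ![])) := by
  ext x
  rw [AlternatingField.onSections_apply, sigma_apply]
  refine DFunLike.congr_fun ?_ x
  rw [← pair_sharpField, pair_d]
  rfl

/-- The tangent space `T_x F` of the symplectic foliation: the image of `♯`. -/
def leafTangent (x : M) : Submodule ℝ (TangentSpace 𝓘(ℝ, E) x) := LinearMap.range (Λ.sharp x)

/-- `♯` has constant rank. -/
def IsRegular : Prop := ∃ r : ℕ, ∀ x : M, Module.finrank ℝ (Λ.leafTangent x) = r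

/-- A transversal distribution: a smooth distribution `νF` with `TM = TF ⊕ νF`. -/
structure Transversal where
  space : ∀ x : M, Submodule ℝ (TangentSpace 𝓘(ℝ, E) x)
  smooth : ∀ (x : M), ∀ v ∈ space x, ∃ X : VectorFields E M, X x = v ∧ ∀ y, X y ∈ space y
  isCompl : ∀ x, IsCompl (Λ.leafTangent x) (space x)

theorem leafTangent_smooth (x : M) (v : TangentSpace 𝓘(ℝ, E) x) (hv : v ∈ Λ.leafTangent x) :
    ∃ X : VectorFields E M, X x = v ∧ ∀ y, X y ∈ Λ.leafTangent y := by
  obtain ⟨a, rfl⟩ := hv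
  obtain ⟨l, hl⟩ := exists_lift (E := E) (V := CotangentSpace E M) (L := OneForms E M) x
  exact ⟨Λ.sharpField (l a), by rw [sharpField_apply, hl], fun y => ⟨_, rfl⟩⟩

namespace Transversal

variable {Λ} (ν : Λ.Transversal)

/-- The projection `T_x M → T_x F` with kernel `ν_x F`. -/
def proj (x : M) : TangentSpace 𝓘(ℝ, E) x →ₗ[ℝ] TangentSpace 𝓘(ℝ, E) x :=
  (Λ.leafTangent x).projection (ν.space x) (ν.isCompl x)

theorem contMDiff_proj (X : VectorFields E M) :
    ContMDiff 𝓘(ℝ, E) (𝓘(ℝ, E).prod 𝓘(ℝ, E)) ∞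
      (fun x => TotalSpace.mk' E x (ν.proj x (X x))) := by
  classical
  intro x₀
  let b := ((Module.finBasis ℝ (Λ.leafTangent x₀)).prod (Module.finBasis ℝ (ν.space x₀))).map
    (Submodule.prodEquivOfIsCompl _ _ (ν.isCompl x₀))
  choose w₁ hw₁ hw₁' using fun k => Λ.leafTangent_smooth x₀ _
    ((Module.finBasis ℝ (Λ.leafTangent x₀)) k).2
  choose w₂ hw₂ hw₂' using fun k => ν.smooth x₀ _ ((Module.finBasis ℝ (ν.space x₀)) k).2
  let w := Sum.elim w₁ w₂
  have hw : ∀ k, w k x₀ = b k := by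
    rintro (k | k)
    · simp [w, b, hw₁]
    · simp [w, b, hw₂]
  obtain ⟨l, hl⟩ := exists_lift (E := E) (V := CotangentSpace E M) (L := OneForms E M) x₀
  let A : Matrix _ _ (SmoothFun E M) :=
    Matrix.of fun j k => OneForms.pair (l (b.coord j)) (w k)
  let u : _ → SmoothFun E M := A.adjugate.mulVec fun j => OneForms.pair (l (b.coord j)) X
  let Y : VectorFields E M := ∑ k, u (Sum.inl k) • w (Sum.inl k)
  let ev : M → SmoothFun E M →+* ℝ := fun y => ContMDiffMap.evalRingHom y
  have hdet0 : A.det x₀ = 1 := by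
    change ev x₀ A.det = 1
    rw [RingHom.map_det]
    have : (ev x₀).mapMatrix A = 1 := by
      ext j k
      change l (b.coord j) x₀ (w k x₀) = _
      rw [hl, hw, Module.Basis.coord_apply, Module.Basis.repr_self, Matrix.one_apply,
        Finsupp.single_apply]
      simp [eq_comm]
    rw [this, Matrix.det_one]
  have key : ∀ y, A.det y ≠ 0 → A.det y • ν.proj y (X y) = Y y := by
    intro y hy
    let Ay := (ev y).mapMatrix A
    have hAy : Ay.det ≠ 0 := by rw [← RingHom.map_det]; exact hy
    have hApp : ∀ c : _ → ℝ, ∀ j, l (b.coord j) y (∑ k, c k • w k y) = Ay.mulVec c j := by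
      intro c j
      simp only [map_sum, map_smul, smul_eq_mul, Matrix.mulVec, dotProduct]
      exact Finset.sum_congr rfl fun k _ => mul_comm _ _
    have hli : LinearIndependent ℝ (fun k => w k y) := by
      rw [Fintype.linearIndependent_iff]
      intro c hc
      have : Ay.mulVec c = 0 := by
        ext j
        rw [← hApp, hc, map_zero]
        rfl
      exact congrFun (Matrix.eq_zero_of_mulVec_eq_zero hAy this)
    have hspan : ⊤ ≤ Submodule.span ℝ (Set.range fun k => w k y) := by
      rw [hli.span_eq_top_of_card_eq_finrank']
      exact (Module.finrank_eq_card_basis b).symm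
    obtain ⟨c, hc⟩ := (Submodule.mem_span_range_iff_exists_fun ℝ).1 (hspan (x := X y) trivial)
    have hu : ∀ k, u k y = Ay.det * c k := by
      have h1 : (fun k => u k y) = Ay.adjugate.mulVec (Ay.mulVec c) := by
        have h2 : (fun j => l (b.coord j) y (X y)) = Ay.mulVec c := by
          ext j; rw [← hApp, hc]
        rw [← h2]
        have h3 : Ay.adjugate = (ev y).mapMatrix A.adjugate := ((ev y).map_adjugate A).symm
        rw [h3]
        ext k
        exact (ev y).map_mulVec A.adjugate _ k
      rw [Matrix.mulVec_mulVec, Matrix.adjugate_mul, Matrix.smul_mulVec, Matrix.one_mulVec] at h1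
      exact fun k => congrFun h1 k
    have hY : Y y = ∑ k, (Ay.det * c (Sum.inl k)) • w₁ k y := by
      refine (coe_sum_section (E := E) (V := (TangentSpace 𝓘(ℝ, E) : M → Type _)) _ _ y).trans ?_
      refine Finset.sum_congr rfl fun k _ => ?_
      rw [vectorFields_smul_apply, hu]
      rfl
    rw [hY, ← hc, map_sum, Fintype.sum_sum_type]
    have e1 : ∀ k, ν.proj y (c (Sum.inl k) • w (Sum.inl k) y) = c (Sum.inl k) • w₁ k y := by
      intro k
      rw [map_smul]
      congr 1
      exact Submodule.projection_apply_of_mem_left _ (hw₁' k y)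
    have e2 : ∀ k, ν.proj y (c (Sum.inr k) • w (Sum.inr k) y) = 0 := by
      intro k
      rw [map_smul]
      have : ν.proj y (w₂ k y) = 0 :=
        (Submodule.projection_apply_eq_zero_iff _).2 (hw₂' k y)
      change c (Sum.inr k) • ν.proj y (w₂ k y) = 0
      rw [this, smul_zero]
    simp only [e1, e2, Finset.sum_const_zero, add_zero, Finset.smul_sum, mul_smul]
    have : A.det y = Ay.det := (ev y).map_det A
    rw [this]
  have hne : ∀ᶠ y in 𝓝 x₀, A.det y ≠ 0 :=
    A.det.contMDiff.continuous.continuousAt.eventually_ne (by rw [hdet0]; exact one_ne_zero)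
  have hinv : ContMDiffAt 𝓘(ℝ, E) 𝓘(ℝ, ℝ) ∞ (fun y => (A.det y)⁻¹) x₀ :=
    (A.det.contMDiff x₀).inv₀ (by rw [hdet0]; exact one_ne_zero)
  refine (hinv.smul_section (Y.contMDiff x₀)).congr_of_eventuallyEq ?_
  filter_upwards [hne] with y hy
  have : ν.proj y (X y) = (A.det y)⁻¹ • Y y := by
    rw [← key y hy, smul_smul, inv_mul_cancel₀ hy, one_smul]
  rw [this]
  rfl

/-- The tangential part of a vector field. -/
def projField (X : VectorFields E M) : VectorFields E M :=
  ⟨fun x => ν.proj x (X x), ν.contMDiff_proj X⟩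

/-- The part in `T*F` of a 1-form, in the decomposition `T*M = T*F ⊕ ν*F`. -/
def projOneForm (α : OneForms E M) : OneForms E M :=
  ⟨fun x => (α x) ∘ₗ ν.proj x, fun X => α.smooth (ν.projField X)⟩

end Transversal

/-- The algebra `I(M)` of Casimir functions: those whose Hamiltonian vector field `(df)^♯`
is trivial. -/
def casimirs : Subalgebra ℝ (SmoothFun E M) where
  carrier := {f | Λ.sharpField (OneForms.d f) = 0}
  add_mem' {f g} hf hg := by
    have h : OneForms.d (f + g) = OneForms.d f + OneForms.d g := OneForms.ext_pair fun X => by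
      simp only [map_add, LinearMap.add_apply, pair_d]
    rw [Set.mem_ofPred_eq] at hf hg ⊢
    rw [h, map_add, hf, hg, add_zero]
  mul_mem' {f g} hf hg := by
    have h : OneForms.d (f * g) = f • OneForms.d g + g • OneForms.d f :=
      OneForms.ext_pair fun X => by
        simp only [map_add, LinearMap.add_apply, map_smul, LinearMap.smul_apply, pair_d,
          Derivation.leibniz]
    rw [Set.mem_ofPred_eq] at hf hg ⊢
    rw [h, map_add, map_smul, map_smul, hf, hg, smul_zero, smul_zero, add_zero]
  algebraMap_mem' c := by
    have h : OneForms.d (algebraMap ℝ (SmoothFun E M) c) = 0 := OneForms.ext_pair fun X => by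
      simp only [pair_d, Derivation.map_algebraMap, map_zero, LinearMap.zero_apply]
    rw [Set.mem_ofPred_eq, h, map_zero]

theorem anchor_sharpField_casimir (f : Λ.casimirs) (α : OneForms E M) :
    (tangentBracket E M).anchor (Λ.sharpField α) (f : SmoothFun E M) = 0 := by
  rw [← pair_d, pair_sharpField, contract_swap, ← pair_sharpField,
    show Λ.sharpField (OneForms.d (f : SmoothFun E M)) = 0 from f.2, map_zero, neg_zero]

theorem leafTangent_casimir (f : Λ.casimirs) (x : M) (v : TangentSpace 𝓘(ℝ, E) x)
    (hv : v ∈ Λ.leafTangent x) : OneForms.d (f : SmoothFun E M) x v = 0 := by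
  obtain ⟨a, rfl⟩ := hv
  obtain ⟨l, hl⟩ := exists_lift (E := E) (V := CotangentSpace E M) (L := OneForms E M) x
  have := DFunLike.congr_fun (Λ.anchor_sharpField_casimir f (l a)) x
  rw [← pair_d, OneForms.pair_apply, sharpField_apply, hl] at this
  exact this

variable {Λ} (ν : Λ.Transversal)

/-- The forms of type `(0, q)`, i.e. the sections of `∧^q(T*F)`: those vanishing as soon as one
argument belongs to `νF`. -/
def Transversal.leafForms (q : ℕ) : Submodule (SmoothFun E M) (Forms E M q) where
  carrier := {η | ∀ (x : M) (v : Fin q → TangentSpace 𝓘(ℝ, E) x),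
    (∃ i, v i ∈ ν.space x) → η x v = 0}
  zero_mem' _ _ _ := rfl
  add_mem' hP hQ x v hv := by simp [hP x v hv, hQ x v hv]
  smul_mem' f P hP x v hv := by simp [hP x v hv]

variable (Λ) in
/-- The multivector fields of type `(0, q)`, i.e. the sections of `∧^q(TF)`: those vanishing as
soon as one argument belongs to `ν*F`, the annihilator of `TF`. -/
def tangential (q : ℕ) : Submodule (SmoothFun E M) (Multivectors E M q) where
  carrier := {Q | ∀ (x : M) (a : Fin q → CotangentSpace E M x),
    (∃ i, a i ∈ (Λ.leafTangent x).dualAnnihilator) → Q x a = 0}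
  zero_mem' _ _ _ := rfl
  add_mem' hP hQ x v hv := by simp [hP x v hv, hQ x v hv]
  smul_mem' f P hP x v hv := by simp [hP x v hv]

namespace Transversal

/-- The component of type `(0, q)` of a `q`-form. -/
def formComponent {q : ℕ} (η : Forms E M q) : Forms E M q :=
  ⟨fun x => (η x).compLinearMap (ν.proj x), fun X => η.smooth fun i => ν.projField (X i)⟩

/-- The component of type `(0, q)` of a `q`-vector field. -/
def multivectorComponent {q : ℕ} (Q : Multivectors E M q) : Multivectors E M q :=
  ⟨fun x => (Q x).compLinearMap (LinearMap.lcomp ℝ ℝ (ν.proj x)),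
    fun α => Q.smooth fun i => ν.projOneForm (α i)⟩

theorem formComponent_mem {q : ℕ} (η : Forms E M q) : ν.formComponent η ∈ ν.leafForms q := by
  rintro x v ⟨i, hi⟩
  exact (η x).map_coord_zero i ((Submodule.projection_apply_eq_zero_iff _).2 hi)

theorem multivectorComponent_mem {q : ℕ} (Q : Multivectors E M q) :
    ν.multivectorComponent Q ∈ Λ.tangential q := by
  rintro x a ⟨i, hi⟩
  refine (Q x).map_coord_zero i ?_
  ext v
  exact (Submodule.mem_dualAnnihilator _).1 hi _ (Submodule.projection_apply_mem _ _)

/-- The leafwise differential `d''` on forms of type `(0, q)`: the component of type `(0, q + 1)`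
of the exterior derivative. -/
def leafD (q : ℕ) : ν.leafForms q →ₗ[Λ.casimirs] ν.leafForms (q + 1) where
  toFun η := ⟨ν.formComponent (η : Forms E M q).d, ν.formComponent_mem _⟩
  map_add' η θ := Subtype.ext <| AlternatingField.ext_sections fun X x => by
    change ((η : Forms E M q) + (θ : Forms E M q)).d x (fun i => ν.projField (X i) x) =
      (η : Forms E M q).d x (fun i => ν.projField (X i) x) +
      (θ : Forms E M q).d x (fun i => ν.projField (X i) x)
    simp only [Forms.d_apply]
    exact DFunLike.congr_fun ((tangentBracket E M).koszul_add (AlternatingField.onSections _)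
      (AlternatingField.onSections _) _) x
  map_smul' f η := Subtype.ext <| AlternatingField.ext_sections fun X x => by
    change ((f : SmoothFun E M) • (η : Forms E M q)).d x (fun i => ν.projField (X i) x) =
      (f : SmoothFun E M) x * (η : Forms E M q).d x (fun i => ν.projField (X i) x)
    simp only [Forms.d_apply]
    refine DFunLike.congr_fun ((tangentBracket E M).koszul_smul (f : SmoothFun E M)
      (AlternatingField.onSections _) _ fun i => ?_) x
    ext y
    exact Λ.leafTangent_casimir f y _ (Submodule.projection_apply_mem _ _)

/-- The coboundary `σ''` on multivector fields of type `(0, q)`: the component of type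
`(0, q + 1)` of `σ = [Λ, ·]`. -/
def tangentialSigma (q : ℕ) : Λ.tangential q →ₗ[Λ.casimirs] Λ.tangential (q + 1) where
  toFun Q := ⟨ν.multivectorComponent (Λ.sigma (Q : Multivectors E M q)),
    ν.multivectorComponent_mem _⟩
  map_add' P Q := Subtype.ext <| AlternatingField.ext_sections fun α x => by
    change Λ.sigma ((P : Multivectors E M q) + (Q : Multivectors E M q)) x
        (fun i => ν.projOneForm (α i) x) =
      Λ.sigma (P : Multivectors E M q) x (fun i => ν.projOneForm (α i) x) +
      Λ.sigma (Q : Multivectors E M q) x (fun i => ν.projOneForm (α i) x)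
    simp only [sigma_apply]
    exact DFunLike.congr_fun (Λ.cotangentBracket.koszul_add (AlternatingField.onSections _)
      (AlternatingField.onSections _) _) x
  map_smul' f Q := Subtype.ext <| AlternatingField.ext_sections fun α x => by
    change Λ.sigma ((f : SmoothFun E M) • (Q : Multivectors E M q)) x
        (fun i => ν.projOneForm (α i) x) =
      (f : SmoothFun E M) x * Λ.sigma (Q : Multivectors E M q) x
        (fun i => ν.projOneForm (α i) x)
    simp only [sigma_apply]
    exact DFunLike.congr_fun (Λ.cotangentBracket.koszul_smul (f : SmoothFun E M)
      (AlternatingField.onSections _) _ fun i => Λ.anchor_sharpField_casimir f _) x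

end Transversal

variable (Λ) in
/-- The extension of `♯` to forms: `(♯η)(α_1,…,α_q) = (-1)^q η(α_1^♯,…,α_q^♯)`. -/
def sharpForm {q : ℕ} (η : Forms E M q) : Multivectors E M q :=
  ⟨fun x => (-1 : ℝ) ^ q • (η x).compLinearMap (Λ.sharp x), fun α =>
    contMDiff_const.mul (η.smooth fun i => Λ.sharpField (α i))⟩

end Multivectors

end Operators

section Cohomology

variable {R : Type*} [CommRing R] {C : ℕ → Type*} [∀ q, AddCommGroup (C q)] [∀ q, Module R (C q)]

/-- The coboundaries of a sequence `C 0 → C 1 → C 2 → ⋯`. -/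
def coboundaries (d : ∀ q, C q →ₗ[R] C (q + 1)) : ∀ q, Submodule R (C q)
  | 0 => ⊥
  | q + 1 => LinearMap.range (d q)

/-- The cohomology `ker / im` of a complex `0 → C 0 → C 1 → C 2 → ⋯` in degree `q`. -/
def Cohomology (d : ∀ q, C q →ₗ[R] C (q + 1)) (q : ℕ) : Type _ :=
  LinearMap.ker (d q) ⧸ (coboundaries d q).submoduleOf (LinearMap.ker (d q))

namespace Cohomology

variable (d : ∀ q, C q →ₗ[R] C (q + 1)) (q : ℕ)

instance : AddCommGroup (Cohomology d q) :=
  inferInstanceAs (AddCommGroup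
    (LinearMap.ker (d q) ⧸ (coboundaries d q).submoduleOf (LinearMap.ker (d q))))

instance : Module R (Cohomology d q) :=
  inferInstanceAs (Module R
    (LinearMap.ker (d q) ⧸ (coboundaries d q).submoduleOf (LinearMap.ker (d q))))

/-- The cohomology class of a cocycle. -/
def mk : LinearMap.ker (d q) →ₗ[R] Cohomology d q :=
  Submodule.mkQ ((coboundaries d q).submoduleOf (LinearMap.ker (d q)))

end Cohomology

end Cohomology

section Operators

variable {E : Type*} [NormedAddCommGroup E] [NormedSpace ℝ E] [FiniteDimensional ℝ E]
  {M : Type*} [TopologicalSpace M] [T2Space M] [ChartedSpace E M] [IsManifold 𝓘(ℝ, E) ∞ M]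

namespace Multivectors.Transversal

variable {Λ : Multivectors E M 2} (ν : Λ.Transversal) (q : ℕ)

/-- The leafwise de Rham cohomology `H^q(M, P^0(F))`: the cohomology of the forms of type
`(0, q)` with the differential `d''`. -/
def LeafCohomology : Type _ := Cohomology ν.leafD q

instance : AddCommGroup (ν.LeafCohomology q) := inferInstanceAs (AddCommGroup (Cohomology _ q))

instance : Module Λ.casimirs (ν.LeafCohomology q) :=
  inferInstanceAs (Module Λ.casimirs (Cohomology _ q))

/-- The class of a `d''`-closed form. -/
def leafClass : LinearMap.ker (ν.leafD q) →ₗ[Λ.casimirs] ν.LeafCohomology q :=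
  Cohomology.mk ν.leafD q

/-- The tangential Poisson cohomology `H^q_{Λ,tan}(M)`: the cohomology of the multivector fields
of type `(0, q)` with the coboundary `σ''`. -/
def TangentialCohomology : Type _ := Cohomology ν.tangentialSigma q

instance : AddCommGroup (ν.TangentialCohomology q) :=
  inferInstanceAs (AddCommGroup (Cohomology _ q))

instance : Module Λ.casimirs (ν.TangentialCohomology q) :=
  inferInstanceAs (Module Λ.casimirs (Cohomology _ q))

/-- The class of a `σ''`-closed multivector field. -/
def tangentialClass :
    LinearMap.ker (ν.tangentialSigma q) →ₗ[Λ.casimirs] ν.TangentialCohomology q :=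
  Cohomology.mk ν.tangentialSigma q

end Multivectors.Transversal

end Operators

end PoissonGeometry

end

/-! For a Poisson bivector the map `♯` is a morphism of Lie algebroids from T*M, with the bracket of
1-forms, to TM: it preserves brackets (`sharpField_bracket`), and a 1-form α acts on functions
through the vector field α^♯. The operators σ and d are the Koszul differentials of these two
structures, so the unsigned pullback η ↦ η(α_1^♯, …, α_q^♯) turns d into σ; this is
`AnchoredBracket.koszul_comp`, specialized in `koszul_pullbackSharp`. Preservation of brackets is
the Jacobi identity of the Poisson bracket when the 1-forms are exact. The general case follows
because the defect {α, β}^♯ - [α^♯, β^♯] is C^∞(M)-bilinear and every covector is the differential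
of a function.

Skew-symmetry of Λ makes ker ♯ the annihilator of im ♯ = TF. Hence `♯` kills ν*F and identifies T*F
with TF. The inverse `flat` is smooth because the rank is constant (`contMDiff_flat`), so pullback
along `♯` is a bijection from forms of type (0, q) onto multivector fields of type (0, q). Since `♯`
takes values in TF and factors through T*F, projecting to components of type (0, q + 1) is
compatible with the pullback, which therefore intertwines d'' with σ'' (`leafFormsEquiv_leafD`).

The identity d'' ∘ d'' = 0 comes from d ∘ d = 0. The latter is proved by Cartan calculus on cochains
of a Lie ring: Cartan's formula defines the differential recursively, and the Koszul expression
satisfies the same recursion (`koszul_vecCons`). The other components of dη do not contribute to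
d''d''η, because brackets of vector fields α^♯ are again of this form. Finally σ'' ∘ σ'' = 0 is
transported through the isomorphism, and an isomorphism of complexes induces one in cohomology. -/

noncomputable section

namespace PoissonGeometry

/-! ### Cartan calculus for cochains of a Lie ring with values in a module -/

section LieCochains

variable {L A : Type*} [LieRing L] [AddCommGroup A] [LieRingModule L A] {q : ℕ}

/-- Contraction of a cochain with `X` in the first argument. -/
def cochainContract (X : L) (F : (Fin (q + 1) → L) → A) : (Fin q → L) → A :=
  fun v => F (Matrix.vecCons X v)

/-- The Lie derivative of a cochain. -/
def cochainLie (X : L) : ∀ {q : ℕ}, ((Fin q → L) → A) → (Fin q → L) → A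
  | 0, F => fun v => ⁅X, F v⁆
  | _ + 1, F => fun v => cochainLie X (cochainContract (v 0) F) (Matrix.vecTail v) -
      cochainContract ⁅X, v 0⁆ F (Matrix.vecTail v)

/-- The Chevalley–Eilenberg differential, defined recursively by Cartan's formula
`ι_X d = L_X - d ι_X`. -/
def cochainD : ∀ {q : ℕ}, ((Fin q → L) → A) → (Fin (q + 1) → L) → A
  | 0, F => fun v => cochainLie (v 0) F (Matrix.vecTail v)
  | _ + 1, F => fun v => cochainLie (v 0) F (Matrix.vecTail v) -
      cochainD (cochainContract (v 0) F) (Matrix.vecTail v)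

/-- Additivity of a cochain in every argument. -/
def IsAdditiveCochain : ∀ {q : ℕ}, ((Fin q → L) → A) → Prop
  | 0, _ => True
  | _ + 1, F => (∀ X Y, cochainContract (X + Y) F = cochainContract X F + cochainContract Y F) ∧
      ∀ X, IsAdditiveCochain (cochainContract X F)

/-- This drives the inductions on the degree below: each identity is tested after contraction with
an arbitrary first argument, where the recursive definitions apply. -/
theorem cochain_ext {F G : (Fin (q + 1) → L) → A}
    (h : ∀ X, cochainContract X F = cochainContract X G) : F = G := by
  ext v
  have := congrFun (h (v 0)) (Matrix.vecTail v)
  rw [← Matrix.cons_head_tail v]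
  exact this

theorem cochainContract_sub (X : L) (F G : (Fin (q + 1) → L) → A) :
    cochainContract X (F - G) = cochainContract X F - cochainContract X G := rfl

/-- The Cartan relation [L_X, ι_Y] = ι_[X,Y], which is the defining recursion of `cochainLie` read
on the head and tail of the argument. -/
theorem cochainContract_lie (X Y : L) (F : (Fin (q + 1) → L) → A) :
    cochainContract Y (cochainLie X F) =
      cochainLie X (cochainContract Y F) - cochainContract ⁅X, Y⁆ F := by
  ext v
  simp [cochainContract, cochainLie]

theorem cochainContract_d (X : L) (F : (Fin (q + 1) → L) → A) :
    cochainContract X (cochainD F) = cochainLie X F - cochainD (cochainContract X F) := by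
  ext v
  simp only [cochainContract, cochainD, Pi.sub_apply, Matrix.cons_val_zero, Matrix.tail_cons]

theorem cochainContract_d_zero (X : L) (F : (Fin 0 → L) → A) :
    cochainContract X (cochainD F) = cochainLie X F := by
  ext v
  simp [cochainContract, cochainD]

theorem cochainLie_sub (X : L) (F G : (Fin q → L) → A) :
    cochainLie X (F - G) = cochainLie X F - cochainLie X G := by
  induction q with
  | zero => ext v; simp [cochainLie]
  | succ q ih =>
    refine cochain_ext fun Y => ?_
    simp only [cochainContract_lie, cochainContract_sub, ih]
    abel

theorem cochainD_sub (F G : (Fin q → L) → A) :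
    cochainD (F - G) = cochainD F - cochainD G := by
  induction q with
  | zero =>
    refine cochain_ext fun Y => ?_
    simp only [cochainContract_d_zero, cochainContract_sub, cochainLie_sub]
  | succ q ih =>
    refine cochain_ext fun Y => ?_
    simp only [cochainContract_d, cochainContract_sub, cochainLie_sub, ih]
    abel

/-- After contraction with Z, the mixed terms L_X ι_[Y,Z] and L_Y ι_[X,Z] occur on both sides. What
remains is the induction hypothesis for ι_Z F and three contractions with iterated brackets, which
cancel by the Jacobi identity. -/
theorem cochainLie_cochainLie (X Y : L) (F : (Fin q → L) → A) (hF : IsAdditiveCochain F) :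
    cochainLie X (cochainLie Y F) = cochainLie Y (cochainLie X F) + cochainLie ⁅X, Y⁆ F := by
  induction q with
  | zero => ext v; simp [cochainLie]
  | succ q ih =>
    refine cochain_ext fun Z => ?_
    -- Additivity of the cochain is needed only here, to split a contraction with a sum of brackets.
    have h : cochainContract ⁅X, ⁅Y, Z⁆⁆ F =
        cochainContract ⁅⁅X, Y⁆, Z⁆ F + cochainContract ⁅Y, ⁅X, Z⁆⁆ F := by
      rw [leibniz_lie, hF.1]
    change _ = cochainContract Z (cochainLie Y (cochainLie X F)) +
      cochainContract Z (cochainLie ⁅X, Y⁆ F)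
    simp only [cochainContract_lie, cochainLie_sub, ih _ (hF.2 Z), h]
    abel

/-- Contraction with Y and Cartan's formula reduce this to the commutator of L_X and L_Y on F and to
the same statement for ι_Y F. -/
theorem cochainLie_cochainD (X : L) (F : (Fin q → L) → A) (hF : IsAdditiveCochain F) :
    cochainLie X (cochainD F) = cochainD (cochainLie X F) := by
  induction q with
  | zero =>
    refine cochain_ext fun Y => ?_
    simp only [cochainContract_lie, cochainContract_d_zero, cochainLie_cochainLie X Y F hF]
    abel
  | succ q ih =>
    refine cochain_ext fun Y => ?_
    simp only [cochainContract_lie, cochainContract_d, cochainLie_sub, cochainD_sub,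
      cochainLie_cochainLie X Y F hF, ih _ (hF.2 Y)]
    abel

/-- Applying Cartan's formula twice gives ι_X d d = L_X d - d L_X + d d ι_X. The first two terms
cancel, and the last vanishes by induction. -/
theorem cochainD_cochainD (F : (Fin q → L) → A) (hF : IsAdditiveCochain F) :
    cochainD (cochainD F) = 0 := by
  induction q with
  | zero =>
    refine cochain_ext fun X => ?_
    rw [cochainContract_d, cochainContract_d_zero, cochainLie_cochainD X F hF, sub_self]
    rfl
  | succ q ih =>
    refine cochain_ext fun X => ?_
    rw [cochainContract_d, cochainContract_d, cochainLie_cochainD X F hF, cochainD_sub,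
      ih _ (hF.2 X), sub_zero, sub_self]
    rfl

/-- The unrolled form of the recursion, needed for the comparison with the sums in `koszul`. -/
theorem cochainLie_apply (X : L) (F : (Fin q → L) → A) (v : Fin q → L) :
    cochainLie X F v = ⁅X, F v⁆ - ∑ i, F (Function.update v i ⁅X, v i⁆) := by
  induction q with
  | zero => simp [cochainLie]
  | succ q ih =>
    obtain ⟨Y, w, rfl⟩ : ∃ Y w, v = Matrix.vecCons Y w :=
      ⟨v 0, Matrix.vecTail v, by simpa [Matrix.vecHead] using (Matrix.cons_head_tail v).symm⟩
    have h0 : Function.update (Matrix.vecCons Y w) 0 ⁅X, Y⁆ = Matrix.vecCons ⁅X, Y⁆ w := by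
      ext j; refine Fin.cases ?_ (fun j => ?_) j <;> simp
    have hs : ∀ i : Fin q, Function.update (Matrix.vecCons Y w) i.succ ⁅X, w i⁆ =
        Matrix.vecCons Y (Function.update w i ⁅X, w i⁆) := fun i => by
      ext j
      refine Fin.cases ?_ (fun j => ?_) j
      · simp [Function.update, (Fin.succ_ne_zero i).symm]
      · by_cases h : j = i <;> simp [Function.update, h]
    have := congrFun (cochainContract_lie X Y F) w
    simp only [cochainContract, Pi.sub_apply, ih] at this
    rw [this, Fin.sum_univ_succ]
    simp only [Matrix.cons_val_zero, Matrix.cons_val_succ, h0, hs]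
    abel

end LieCochains

/-! ### The exterior derivative as a Chevalley–Eilenberg differential, and d ∘ d = 0 -/

section TangentDifferential

variable {E : Type*} [NormedAddCommGroup E] [NormedSpace ℝ E] [FiniteDimensional ℝ E]
  {M : Type*} [TopologicalSpace M] [ChartedSpace E M] [IsManifold 𝓘(ℝ, E) ∞ M] [T2Space M]
  {q : ℕ}

theorem tangentBracket_jacobi (X Y Z : VectorFields E M) :
    (tangentBracket E M).bracket X ((tangentBracket E M).bracket Y Z) =
      (tangentBracket E M).bracket ((tangentBracket E M).bracket X Y) Z +
        (tangentBracket E M).bracket Y ((tangentBracket E M).bracket X Z) := by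
  have : CompleteSpace E := FiniteDimensional.complete ℝ E
  have h : minSmoothness ℝ 2 ≤ ∞ := by
    rw [minSmoothness_of_isRCLikeNormedField]
    exact ENat.LEInfty.out
  ext x
  exact leibniz_identity_mlieBracket_apply (X.contMDiff.contMDiffAt.of_le h)
    (Y.contMDiff.contMDiffAt.of_le h) (Z.contMDiff.contMDiffAt.of_le h)

theorem tangentBracket_anchor_bracket (X Y : VectorFields E M) (f : SmoothFun E M) :
    (tangentBracket E M).anchor ((tangentBracket E M).bracket X Y) f =
      (tangentBracket E M).anchor X ((tangentBracket E M).anchor Y f) -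
        (tangentBracket E M).anchor Y ((tangentBracket E M).anchor X f) :=
  have : CompleteSpace E := FiniteDimensional.complete ℝ E
  VectorFields.derivation_lie X Y f

instance : LieRing (VectorFields E M) where
  bracket X Y := (tangentBracket E M).bracket X Y
  add_lie X Y Z := by
    change (tangentBracket E M).bracket (X + Y) Z = _
    rw [map_add]; rfl
  lie_add X Y Z := map_add ((tangentBracket E M).bracket X) Y Z
  lie_self X := (tangentBracket E M).bracket_self X
  leibniz_lie := tangentBracket_jacobi

instance : LieRingModule (VectorFields E M) (SmoothFun E M) where
  bracket X f := (tangentBracket E M).anchor X f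
  add_lie X Y f := by
    change (tangentBracket E M).anchor (X + Y) f = _
    rw [map_add]; rfl
  lie_add X f g := map_add ((tangentBracket E M).anchor X) f g
  leibniz_lie X Y f := by
    change _ = (tangentBracket E M).anchor ((tangentBracket E M).bracket X Y) f +
      (tangentBracket E M).anchor Y ((tangentBracket E M).anchor X f)
    rw [tangentBracket_anchor_bracket, sub_add_cancel]

theorem isAdditiveCochain_alternatingMap
    (Q : VectorFields E M [⋀^Fin q]→ₗ[SmoothFun E M] SmoothFun E M) : IsAdditiveCochain Q := by
  induction q with
  | zero => trivial
  | succ q ih =>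
    refine ⟨fun X Y => ?_, fun X => ih (Q.curryLeft X)⟩
    ext1 v
    exact Q.map_vecCons_add v X Y

theorem sum_ge_zero {n : ℕ} {A : Type*} [AddCommMonoid A] (g : Fin (n + 1) → A) :
    ∑ j ≥ (0 : Fin (n + 1)), g j = ∑ j, g j := by
  refine Finset.sum_congr ?_ fun _ _ => rfl
  ext j
  simp

/-- Reindexes the rows of the double Koszul sum that remain after the row i = 0 has been split off.
-/
theorem sum_ge_succ {n : ℕ} {A : Type*} [AddCommMonoid A] (i : Fin n) (g : Fin (n + 1) → A) :
    ∑ j ≥ i.succ, g j = ∑ j ≥ i, g j.succ := by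
  have h : Finset.Ici i.succ = (Finset.Ici i).map (Fin.succEmb n) := by
    ext j
    refine Fin.cases ?_ (fun j => ?_) j <;> simp
  rw [h, Finset.sum_map]
  rfl

/-- Cartan's formula ι_X d = L_X - d ι_X for the Koszul expression. The terms with i = 0, in which X
acts or is bracketed, add up to the Lie derivative; all others carry X as an argument and form the
Koszul expression of ι_X Q with reversed sign. -/
theorem koszul_vecCons (Q : VectorFields E M [⋀^Fin (q + 1)]→ₗ[SmoothFun E M] SmoothFun E M)
    (X : VectorFields E M) (v : Fin (q + 1) → VectorFields E M) :
    (tangentBracket E M).koszul Q (Matrix.vecCons X v) =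
      cochainLie X Q v - (tangentBracket E M).koszul (Q.curryLeft X) v := by
  -- Moving the bracket from the first slot to slot i costs the sign (-1)^i.
  have h1 : ∀ i : Fin (q + 1), (-1 : ℤ) ^ (i : ℕ) •
      Q (Matrix.vecCons ((tangentBracket E M).bracket X (v i)) (i.removeNth v)) =
      Q (Function.update v i ⁅X, v i⁆) := fun i => by
    have h := Q.map_insertNth i ⁅X, v i⁆ (i.removeNth v)
    rw [Fin.insertNth_removeNth] at h
    exact h.symm
  have h2 : ∑ j ≥ (0 : Fin (q + 1)), (-1 : ℤ) ^ (((0 : Fin (q + 1)) : ℕ) + (j : ℕ)) •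
      Q (Matrix.vecCons ((tangentBracket E M).bracket
          (Matrix.vecCons X v (0 : Fin (q + 1)).castSucc) (Matrix.vecCons X v j.succ))
        (j.removeNth ((0 : Fin (q + 1)).castSucc.removeNth (Matrix.vecCons X v)))) =
      ∑ j, Q (Function.update v j ⁅X, v j⁆) := by
    rw [sum_ge_zero]
    refine Finset.sum_congr rfl fun j _ => ?_
    rw [← h1, Fin.val_zero, zero_add]
    rfl
  have h3 : ∑ i : Fin (q + 2), (-1 : ℤ) ^ (i : ℕ) • (tangentBracket E M).anchor
      (Matrix.vecCons X v i) (Q (i.removeNth (Matrix.vecCons X v))) =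
      ⁅X, Q v⁆ - ∑ i : Fin (q + 1), (-1 : ℤ) ^ (i : ℕ) • (tangentBracket E M).anchor
        (v i) (Q.curryLeft X (i.removeNth v)) := by
    rw [Fin.sum_univ_succ, sub_eq_add_neg, ← Finset.sum_neg_distrib]
    congr 1
    · rw [Fin.val_zero, pow_zero, one_smul]
      rfl
    · refine Finset.sum_congr rfl fun i _ => ?_
      rw [AnchoredBracket.removeNth_succ_cons, Fin.val_succ, pow_succ, mul_neg_one, neg_smul]
      rfl
  rw [cochainLie_apply, AnchoredBracket.koszul, Fin.sum_univ_succ (n := q), h2, h3]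
  -- The contracted map has degree q. For q = 0 its Koszul expression has no bracket sum, so this
  -- degree is treated separately.
  cases q with
  | zero =>
    rw [AnchoredBracket.koszul, Finset.univ_eq_empty (α := Fin 0), Finset.sum_empty, add_zero,
      Fin.sum_univ_one, Fin.val_zero, pow_zero, one_smul,
      Subsingleton.elim (Fin.removeNth 0 v) ![]]
    abel
  | succ q =>
    -- Both indices shift by one, which leaves (-1)^(i+j) unchanged. The minus sign comes from
    -- exchanging X with the bracket in the first two slots.
    have h4 : ∑ i : Fin (q + 1), ∑ j ≥ i.succ, (-1 : ℤ) ^ ((i.succ : ℕ) + (j : ℕ)) •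
        Q (Matrix.vecCons ((tangentBracket E M).bracket
          (Matrix.vecCons X v i.succ.castSucc) (Matrix.vecCons X v j.succ))
          (j.removeNth (i.succ.castSucc.removeNth (Matrix.vecCons X v)))) =
        -∑ i : Fin (q + 1), ∑ j ≥ i, (-1 : ℤ) ^ ((i : ℕ) + (j : ℕ)) •
        Q.curryLeft X (Matrix.vecCons ((tangentBracket E M).bracket (v i.castSucc) (v j.succ))
          (j.removeNth (i.castSucc.removeNth v))) := by
      rw [← Finset.sum_neg_distrib]
      refine Finset.sum_congr rfl fun i _ => ?_
      rw [sum_ge_succ, ← Finset.sum_neg_distrib]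
      refine Finset.sum_congr rfl fun j _ => ?_
      rw [← Fin.succ_castSucc, AnchoredBracket.removeNth_succ_cons,
        AnchoredBracket.removeNth_succ_cons, Matrix.cons_val_succ, Matrix.cons_val_succ,
        AlternatingMap.curryLeft_apply_apply, ← smul_neg, Fin.val_succ, Fin.val_succ,
        show (i : ℕ) + 1 + ((j : ℕ) + 1) = i + j + 2 by ring, pow_add, neg_one_sq, mul_one]
      congr 1
      generalize (tangentBracket E M).bracket (v i.castSucc) (v j.succ) = Z
      generalize (j.removeNth (i.castSucc.removeNth v)) = w
      have h := Q.map_swap (Matrix.vecCons X (Matrix.vecCons Z w)) (i := 0) (j := 1) (by simp)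
      rw [← h]
      congr 1
      ext k : 1
      refine Fin.cases ?_ (fun k => Fin.cases ?_ (fun k => ?_) k) k
      · simp
      · simp
      · have : Equiv.swap (0 : Fin (q + 2)) 1 k.succ.succ = k.succ.succ :=
          Equiv.swap_apply_of_ne_of_ne (Fin.succ_ne_zero _)
            (fun h => Fin.succ_ne_zero k (Fin.succ_injective _ h))
        simp [this]
    rw [h4, AnchoredBracket.koszul]
    abel

/-- Both sides obey the same recursion in the first argument and agree in degree 0. -/
theorem koszul_eq_cochainD (Q : VectorFields E M [⋀^Fin q]→ₗ[SmoothFun E M] SmoothFun E M)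
    (s : Fin (q + 1) → VectorFields E M) :
    (tangentBracket E M).koszul Q s = cochainD Q s := by
  induction q with
  | zero =>
    rw [AnchoredBracket.koszul]
    exact congrArg (fun u => (tangentBracket E M).anchor (s 0) (Q u)) (Subsingleton.elim _ _)
  | succ q ih =>
    conv_lhs => rw [← Matrix.cons_head_tail s]
    rw [koszul_vecCons, ih]
    rfl

/-- This is d ∘ d = 0, inherited from the cochain differential because multilinear maps are additive
cochains. -/
theorem koszul_koszulMap (Q : VectorFields E M [⋀^Fin q]→ₗ[SmoothFun E M] SmoothFun E M)
    (s : Fin (q + 2) → VectorFields E M) :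
    (tangentBracket E M).koszul ((tangentBracket E M).koszulMap Q) s = 0 := by
  rw [koszul_eq_cochainD]
  have h : ((tangentBracket E M).koszulMap Q : (Fin (q + 1) → VectorFields E M) → SmoothFun E M) =
      cochainD Q := funext fun v => koszul_eq_cochainD Q v
  rw [h, cochainD_cochainD _ (isAdditiveCochain_alternatingMap Q)]
  rfl

theorem Forms.onSections_d (η : Forms E M q) :
    η.d.onSections = (tangentBracket E M).koszulMap η.onSections := by
  ext X x
  exact η.d_apply X x

end TangentDifferential

/-- Exchanging the arguments one at a time changes the value only by terms with an argument in K. It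
serves both type conditions, with K = νF for forms and K = ν*F for multivector fields. -/
theorem _root_.AlternatingMap.congr_of_sub_mem {R V N ι : Type*} [CommRing R] [AddCommGroup V]
    [AddCommGroup N] [Module R V] [Module R N] [Fintype ι] (f : V [⋀^ι]→ₗ[R] N)
    (K : Submodule R V) (hf : ∀ v : ι → V, (∃ i, v i ∈ K) → f v = 0) {v w : ι → V}
    (h : ∀ i, v i - w i ∈ K) : f v = f w := by
  classical
  have step : ∀ A : Finset ι, f (A.piecewise v w) = f w := by
    intro A
    induction A using Finset.induction_on with
    | empty => simp
    | insert i A hi ih =>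
      rw [← ih, Finset.piecewise_insert]
      have e : A.piecewise v w = Function.update (A.piecewise v w) i (w i) := by
        conv_lhs => rw [← Function.update_eq_self i (A.piecewise v w)]
        simp [hi]
      conv_rhs => rw [e]
      rw [← sub_eq_zero, ← f.map_update_sub]
      exact hf _ ⟨i, by simpa using h i⟩
  simpa using step Finset.univ

/-! ### The map `♯` as a morphism of brackets -/

section Anchor

variable {E : Type*} [NormedAddCommGroup E] [NormedSpace ℝ E] [FiniteDimensional ℝ E]
  {M : Type*} [TopologicalSpace M] [T2Space M] [ChartedSpace E M] [IsManifold 𝓘(ℝ, E) ∞ M]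

/-- Every covector is the differential of a smooth function. -/
theorem exists_d_apply_eq (x : M) (a : CotangentSpace E M x) :
    ∃ f : SmoothFun E M, OneForms.d f x = a := by
  have : IsManifold 𝓘(ℝ, E) 1 M := IsManifold.of_le (n := ∞) (by simp)
  obtain ⟨e, he⟩ := isInvertible_mfderiv_extChartAt (I := 𝓘(ℝ, E)) (mem_extChartAt_source x)
  let φ := extChartAt 𝓘(ℝ, E) x
  -- The covector is carried to the model space by the inverse derivative of the chart. The
  -- composite of this linear functional with the chart has differential `a` at x, and a bump
  -- function makes it global.
  let l : E →L[ℝ] ℝ := LinearMap.toContinuousLinearMap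
    ((show TangentSpace 𝓘(ℝ, E) x →ₗ[ℝ] ℝ from a) ∘ₗ
      (show E →ₗ[ℝ] TangentSpace 𝓘(ℝ, E) x from e.symm.toLinearEquiv.toLinearMap))
  let ψ : SmoothBumpFunction 𝓘(ℝ, E) x := Classical.arbitrary _
  have hl : ContMDiffOn 𝓘(ℝ, E) 𝓘(ℝ, ℝ) ∞ (l ∘ φ) (chartAt E x).source :=
    l.contMDiff.comp_contMDiffOn contMDiffOn_extChartAt
  refine ⟨⟨_, ψ.contMDiff_smul hl⟩, ?_⟩
  ext v
  have h1 : (fun y => ψ y • (l ∘ φ) y) =ᶠ[𝓝 x] (l ∘ φ) := by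
    filter_upwards [ψ.eventuallyEq_one] with y hy
    simp [hy]
  have h2 : mfderiv 𝓘(ℝ, E) 𝓘(ℝ, ℝ) (fun y => ψ y • (l ∘ φ) y) x v =
      l (mfderiv 𝓘(ℝ, E) 𝓘(ℝ, E) φ x v) := by
    rw [h1.mfderiv_eq]
    have h3 : MDifferentiableAt 𝓘(ℝ, E) 𝓘(ℝ, E) φ x :=
      mdifferentiableAt_extChartAt (mem_chart_source E x)
    have h5 := mfderiv_comp x (l.differentiableAt.mdifferentiableAt (x := φ x)) h3
    rw [mfderiv_eq_fderiv, l.fderiv] at h5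
    exact DFunLike.congr_fun h5 v
  refine h2.trans ?_
  change a (e.symm (mfderiv 𝓘(ℝ, E) 𝓘(ℝ, E) φ x v)) = a v
  rw [← he]
  exact congrArg a (e.symm_apply_apply v)

/-- A `C^∞(M)`-linear map on sections is pointwise. -/
theorem tensorial_linear {V : M → Type*} [∀ x, AddCommGroup (V x)] [∀ x, Module ℝ (V x)]
    {L : Type*} [DFunLike L M V] [AddCommGroup L] [Module ℝ L] [Module (SmoothFun E M) L]
    [IsSectionModule E V L] (T : L →ₗ[SmoothFun E M] SmoothFun E M) {x : M} {s t : L}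
    (h : s x = t x) : T s x = T t x :=
  tensorial (V := V)
    (AlternatingMap.ofSubsingleton (SmoothFun E M) L (SmoothFun E M) (0 : Fin 1) T) x
    (s := fun _ => s) (t := fun _ => t) fun _ => h

/-- Naturality of the Koszul expression under morphisms of anchored brackets. -/
theorem AnchoredBracket.koszul_comp {L L' : Type*} [AddCommGroup L] [Module ℝ L]
    [Module (SmoothFun E M) L] [AddCommGroup L'] [Module ℝ L'] [Module (SmoothFun E M) L']
    (B : AnchoredBracket E M L) (B' : AnchoredBracket E M L') (φ : L' → L)
    (hbr : ∀ s t, φ (B'.bracket s t) = B.bracket (φ s) (φ t))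
    (hanchor : ∀ s, B.anchor (φ s) = B'.anchor s) {q : ℕ}
    (Q : L [⋀^Fin q]→ₗ[SmoothFun E M] SmoothFun E M)
    (Q' : L' [⋀^Fin q]→ₗ[SmoothFun E M] SmoothFun E M)
    (hQ : ∀ s, Q' s = Q (φ ∘ s)) (s : Fin (q + 1) → L') :
    B'.koszul Q' s = B.koszul Q (φ ∘ s) := by
  cases q with
  | zero =>
    rw [koszul, koszul, hQ, Subsingleton.elim (φ ∘ ![]) ![]]
    exact congrArg (fun D : Derivation _ _ _ => D _) (hanchor _).symm
  | succ q =>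
    have hcons : ∀ {n : ℕ} (a : L') (v : Fin n → L'),
        φ ∘ Matrix.vecCons a v = Matrix.vecCons (φ a) (φ ∘ v) := fun a v => by
      ext j; refine Fin.cases ?_ (fun j => ?_) j <;> simp
    simp only [koszul, hQ, hcons, hbr, ← hanchor]
    rfl

namespace Multivectors

variable (Λ : Multivectors E M 2)

theorem apply_sharp_swap (x : M) (a b : CotangentSpace E M x) :
    b (Λ.sharp x a) = -a (Λ.sharp x b) := by
  rw [apply_sharp, apply_sharp]
  have h := (Λ x).map_swap ![a, b] (i := 0) (j := 1) (by simp)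
  rw [← neg_eq_iff_eq_neg, ← h]
  congr 1
  ext i : 1
  fin_cases i <;> simp

/-- By skew-symmetry `♯` is minus its own transpose, so its kernel is the annihilator of its image.
Thus `♯` kills exactly ν*F. -/
theorem sharp_eq_zero_iff (x : M) (a : CotangentSpace E M x) :
    Λ.sharp x a = 0 ↔ a ∈ (Λ.leafTangent x).dualAnnihilator := by
  rw [Submodule.mem_dualAnnihilator]
  constructor
  · rintro h _ ⟨b, rfl⟩
    rw [apply_sharp_swap, h, map_zero, neg_zero]
  · intro h
    refine (Module.forall_dual_apply_eq_zero_iff ℝ _).1 fun b => ?_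
    rw [apply_sharp_swap, h _ ⟨b, rfl⟩, neg_zero]

theorem cotangentBracket_anchor (α : OneForms E M) :
    Λ.cotangentBracket.anchor α = (tangentBracket E M).anchor (Λ.sharpField α) := rfl

/-- The failure `{α, β}^♯ - [α^♯, β^♯]` of `♯` to preserve brackets, which is tensorial. -/
def sharpDefect : OneForms E M →ₗ[SmoothFun E M] OneForms E M →ₗ[SmoothFun E M]
    VectorFields E M :=
  LinearMap.mk₂ _ (fun α β => Λ.sharpField (Λ.cotangentBracket.bracket α β) -
      (tangentBracket E M).bracket (Λ.sharpField α) (Λ.sharpField β))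
    (fun α β γ => by simp only [map_add, LinearMap.add_apply]; abel)
    -- The derivative terms in the two Leibniz rules cancel, since the action of 1-forms on
    -- functions is that of their images under `♯`.
    (fun f α β => by
      simp only [AnchoredBracket.smul_bracket, map_sub, map_smul, smul_sub,
        cotangentBracket_anchor]
      abel)
    (fun α β γ => by simp only [map_add]; abel)
    (fun f α β => by
      simp only [AnchoredBracket.bracket_smul, map_add, map_smul, smul_sub,
        cotangentBracket_anchor]
      abel)

variable {Λ}

/-- Since {df, dg} = d{f, g}, the claim says that the Hamiltonian field of {f, g} is the commutator
of those of f and g. Tested on a function h, this is the Jacobi identity, which enters the proof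
only here. -/
theorem sharpDefect_d {B : PoissonBracket E M} (hΛ : B.IsBivector Λ) (f g : SmoothFun E M) :
    Λ.sharpDefect (OneForms.d f) (OneForms.d g) = 0 := by
  have hc : ∀ f g, Λ.contract (OneForms.d f) (OneForms.d g) = B.bracket f g := fun f g => by
    ext x
    rw [hΛ f g x, ← pair_sharpField]
    exact apply_sharp _ _ _ _
  have ha : ∀ f g, (tangentBracket E M).anchor (Λ.sharpField (OneForms.d f)) g =
      B.bracket f g := fun f g => by rw [← pair_d, pair_sharpField, hc]
  ext x
  refine (Module.forall_dual_apply_eq_zero_iff ℝ _).1 fun b => ?_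
  obtain ⟨h, rfl⟩ := exists_d_apply_eq (E := E) x b
  refine DFunLike.congr_fun (?_ : OneForms.pair (OneForms.d h)
    (Λ.sharpDefect (OneForms.d f) (OneForms.d g)) = 0) x
  change OneForms.pair (OneForms.d h) (Λ.sharpField (Λ.formBracket _ _) - _) = 0
  rw [formBracket_d, map_sub, pair_d, pair_d, hc, ha, tangentBracket_anchor_bracket, ha, ha, ha,
    ha]
  have hj := B.jacobi f g h
  rw [B.skew (B.bracket g h), B.skew (B.bracket h f), B.skew h f, map_neg, neg_neg] at hj
  rw [← hj]
  ring

/-- For a Poisson bivector, `♯` preserves brackets. -/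
theorem sharpField_bracket {B : PoissonBracket E M} (hΛ : B.IsBivector Λ) (α β : OneForms E M) :
    Λ.sharpField (Λ.cotangentBracket.bracket α β) =
      (tangentBracket E M).bracket (Λ.sharpField α) (Λ.sharpField β) := by
  refine sub_eq_zero.1 (?_ : Λ.sharpDefect α β = 0)
  ext x
  refine (Module.forall_dual_apply_eq_zero_iff ℝ _).1 fun c => ?_
  obtain ⟨h, rfl⟩ := exists_d_apply_eq (E := E) x c
  -- The defect at x depends only on the values of α and β there, so both may be replaced by exact
  -- forms with the same values.
  obtain ⟨f, hf⟩ := exists_d_apply_eq (E := E) x (α x)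
  obtain ⟨g, hg⟩ := exists_d_apply_eq (E := E) x (β x)
  have h1 := tensorial_linear (V := CotangentSpace E M)
    ((OneForms.pair (OneForms.d h)) ∘ₗ Λ.sharpDefect.flip β) hf
  have h2 := tensorial_linear (V := CotangentSpace E M)
    ((OneForms.pair (OneForms.d h)) ∘ₗ Λ.sharpDefect (OneForms.d f)) hg
  refine h1.symm.trans (h2.symm.trans ?_)
  rw [LinearMap.comp_apply, sharpDefect_d hΛ, map_zero]
  rfl

end Multivectors

end Anchor

/-! ### The inverse of `♯` along the leaves and its smoothness -/

section Flat

variable {E : Type*} [NormedAddCommGroup E] [NormedSpace ℝ E] [FiniteDimensional ℝ E]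
  {M : Type*} [TopologicalSpace M] [T2Space M] [ChartedSpace E M] [IsManifold 𝓘(ℝ, E) ∞ M]

namespace Multivectors.Transversal

variable {Λ : Multivectors E M 2} (ν : Λ.Transversal)

theorem proj_mem (x : M) (v : TangentSpace 𝓘(ℝ, E) x) : ν.proj x v ∈ Λ.leafTangent x :=
  Submodule.projection_apply_mem _ _

theorem proj_of_mem {x : M} {v : TangentSpace 𝓘(ℝ, E) x} (hv : v ∈ Λ.leafTangent x) :
    ν.proj x v = v :=
  Submodule.projection_apply_of_mem_left _ hv

theorem proj_sharp (x : M) (a : CotangentSpace E M x) :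
    ν.proj x (Λ.sharp x a) = Λ.sharp x a := ν.proj_of_mem ⟨a, rfl⟩

theorem sub_proj_mem (x : M) (v : TangentSpace 𝓘(ℝ, E) x) : v - ν.proj x v ∈ ν.space x := by
  rw [← Submodule.projection_apply_eq_zero_iff (ν.isCompl x), map_sub, sub_eq_zero]
  exact (ν.proj_of_mem (ν.proj_mem x v)).symm

/-- Projecting a covector to T*F changes it by an annihilator of TF, which `♯` kills. -/
theorem sharp_comp_proj (x : M) (a : CotangentSpace E M x) :
    Λ.sharp x (a ∘ₗ ν.proj x) = Λ.sharp x a := by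
  rw [← sub_eq_zero, ← map_sub, sharp_eq_zero_iff, Submodule.mem_dualAnnihilator]
  intro v hv
  rw [LinearMap.sub_apply, LinearMap.comp_apply, ν.proj_of_mem hv, sub_self]

/-- The equation `a ∘ₗ ν.proj x = a` expresses that a lies in T*F. The difference of two such
covectors with equal images annihilates TF, and it already vanishes on νF. -/
theorem eq_of_sharp_eq {x : M} {a b : CotangentSpace E M x} (ha : a ∘ₗ ν.proj x = a)
    (hb : b ∘ₗ ν.proj x = b) (h : Λ.sharp x a = Λ.sharp x b) : a = b := by
  rw [← sub_eq_zero, ← map_sub, sharp_eq_zero_iff, Submodule.mem_dualAnnihilator] at h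
  ext v
  have := h _ (ν.proj_mem x v)
  rw [← LinearMap.comp_apply, LinearMap.sub_comp, ha, hb] at this
  exact sub_eq_zero.1 this

theorem exists_flat (x : M) (v : TangentSpace 𝓘(ℝ, E) x) :
    ∃ a : CotangentSpace E M x, a ∘ₗ ν.proj x = a ∧ Λ.sharp x a = ν.proj x v := by
  obtain ⟨a, ha⟩ := ν.proj_mem x v
  refine ⟨a ∘ₗ ν.proj x, ?_, by rw [sharp_comp_proj, ha]⟩
  ext w
  exact congrArg a (ν.proj_of_mem (ν.proj_mem x w))

/-- The inverse `TF → T*F` of `♯`, extended by zero to `νF`. -/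
def flat (x : M) : TangentSpace 𝓘(ℝ, E) x →ₗ[ℝ] CotangentSpace E M x where
  toFun v := (ν.exists_flat x v).choose
  map_add' v w := by
    have hv := (ν.exists_flat x v).choose_spec
    have hw := (ν.exists_flat x w).choose_spec
    have hvw := (ν.exists_flat x (v + w)).choose_spec
    -- The chosen preimage is linear in the vector because preimages in T*F are unique.
    refine ν.eq_of_sharp_eq hvw.1 ?_ ?_
    · rw [LinearMap.add_comp, hv.1, hw.1]
    · exact hvw.2.trans ((map_add _ v w).trans (((map_add _ _ _).trans
        (congrArg₂ (· + ·) hv.2 hw.2)).symm))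
  map_smul' c v := by
    have hv := (ν.exists_flat x v).choose_spec
    have hcv := (ν.exists_flat x (c • v)).choose_spec
    refine ν.eq_of_sharp_eq hcv.1 ?_ ?_
    · rw [LinearMap.smul_comp, RingHom.id_apply, hv.1]
    · exact hcv.2.trans ((map_smul _ c v).trans (((map_smul _ _ _).trans
        (congrArg (c • ·) hv.2)).symm))

theorem flat_comp_proj (x : M) (v : TangentSpace 𝓘(ℝ, E) x) : ν.flat x v ∘ₗ ν.proj x = ν.flat x v :=
  (ν.exists_flat x v).choose_spec.1

theorem sharp_flat (x : M) (v : TangentSpace 𝓘(ℝ, E) x) : Λ.sharp x (ν.flat x v) = ν.proj x v :=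
  (ν.exists_flat x v).choose_spec.2

theorem flat_eq_zero {x : M} {v : TangentSpace 𝓘(ℝ, E) x} (hv : v ∈ ν.space x) :
    ν.flat x v = 0 := by
  refine ν.eq_of_sharp_eq (ν.flat_comp_proj x v) (LinearMap.zero_comp _) ?_
  rw [sharp_flat, map_zero]
  exact (Submodule.projection_apply_eq_zero_iff _).2 hv

/-- A covector of `T*F` whose image under `♯` is killed by all of `T*F` is trivial. -/
theorem eq_zero_of_forall_apply_sharp {x : M} {a : CotangentSpace E M x} (ha : a ∘ₗ ν.proj x = a)
    (h : ∀ b : CotangentSpace E M x, b ∘ₗ ν.proj x = b → b (Λ.sharp x a) = 0) : a = 0 := by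
  refine ν.eq_of_sharp_eq ha (LinearMap.zero_comp _) ?_
  rw [map_zero]
  refine (Module.forall_dual_apply_eq_zero_iff ℝ _).1 fun b => ?_
  have := h (b ∘ₗ ν.proj x) (by ext w; exact congrArg b (ν.proj_of_mem (ν.proj_mem x w)))
  rwa [LinearMap.comp_apply, proj_sharp] at this

/-- The space `T*_x F` of covectors which vanish on `ν_x F`. -/
def leafCotangent (x : M) : Submodule ℝ (CotangentSpace E M x) where
  carrier := {a | a ∘ₗ ν.proj x = a}
  zero_mem' := LinearMap.zero_comp _
  add_mem' {a b} ha hb := by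
    rw [Set.mem_ofPred_eq] at *
    rw [LinearMap.add_comp, ha, hb]
  smul_mem' c a ha := by
    rw [Set.mem_ofPred_eq] at *
    rw [LinearMap.smul_comp, ha]

/-- The isomorphism `T*_x F ≃ T_x F` given by `♯`. -/
def leafCotangentEquiv (x : M) : ν.leafCotangent x ≃ₗ[ℝ] Λ.leafTangent x := by
  refine LinearEquiv.ofBijective ((Λ.sharp x).restrict
    (p := ν.leafCotangent x) (q := Λ.leafTangent x) fun a _ => ⟨a, rfl⟩) ⟨?_, ?_⟩
  · rintro ⟨a, ha⟩ ⟨b, hb⟩ h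
    exact Subtype.ext (ν.eq_of_sharp_eq ha hb (congrArg Subtype.val h))
  · rintro ⟨v, hv⟩
    exact ⟨⟨ν.flat x v, ν.flat_comp_proj x v⟩,
      Subtype.ext ((ν.sharp_flat x v).trans (ν.proj_of_mem hv))⟩

/-- Cramer's rule in a local frame of T*F: the matrix of Λ in the frame is invertible near the base
point, so the coefficients of `flat X` are quotients of smooth functions by its determinant. -/
theorem contMDiff_flat (hreg : Λ.IsRegular) (X Y : VectorFields E M) :
    ContMDiff 𝓘(ℝ, E) 𝓘(ℝ, ℝ) ∞ (fun x => ν.flat x (X x) (Y x)) := by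
  classical
  obtain ⟨r, hr⟩ := hreg
  intro x₀
  obtain ⟨b⟩ : Nonempty (Module.Basis (Fin r) ℝ (ν.leafCotangent x₀)) :=
    ⟨(Module.finBasisOfFinrankEq ℝ (Λ.leafTangent x₀) (hr x₀)).map (ν.leafCotangentEquiv x₀).symm⟩
  obtain ⟨l, hl⟩ := exists_lift (E := E) (V := CotangentSpace E M) (L := OneForms E M) x₀
  -- Global sections of T*F that extend a basis at the base point.
  let α : Fin r → OneForms E M := fun k => ν.projOneForm (l (b k))
  have hα : ∀ k y, α k y ∘ₗ ν.proj y = α k y := fun k y => by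
    ext v
    exact congrArg (l (b k) y) (ν.proj_of_mem (ν.proj_mem y v))
  have hα₀ : ∀ k, α k x₀ = b k := fun k => by
    change l (b k) x₀ ∘ₗ ν.proj x₀ = b k
    rw [hl]
    exact (b k).2
  have hαmem : ∀ (y : M) (c : Fin r → ℝ), (∑ k, c k • α k y) ∘ₗ ν.proj y = ∑ k, c k • α k y :=
    fun y c => (ν.leafCotangent y).sum_mem fun k _ => (ν.leafCotangent y).smul_mem _ (hα k y)
  let A : Matrix (Fin r) (Fin r) (SmoothFun E M) :=
    Matrix.of fun j k => OneForms.pair (α j) (Λ.sharpField (α k))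
  -- The adjugate keeps the computation inside C^∞(M), where the determinant need not be a unit;
  -- division happens only near the base point.
  let u : Fin r → SmoothFun E M := A.adjugate.mulVec fun j => OneForms.pair (α j) X
  let β : OneForms E M := ∑ k, u k • α k
  let ev : M → SmoothFun E M →+* ℝ := fun y => ContMDiffMap.evalRingHom y
  have hdet : ∀ y, A.det y = ((ev y).mapMatrix A).det := fun y => (ev y).map_det A
  have hApp : ∀ (y : M) (c : Fin r → ℝ) (j : Fin r),
      α j y (Λ.sharp y (∑ k, c k • α k y)) = ((ev y).mapMatrix A).mulVec c j := by
    intro y c j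
    simp only [map_sum, map_smul, smul_eq_mul, Matrix.mulVec, dotProduct]
    exact Finset.sum_congr rfl fun k _ => mul_comm _ _
  -- A kernel vector would give a covector in T*F whose image under `♯` is killed by a basis of T*F.
  -- Such a covector is zero, against linear independence of the basis.
  have hdet0 : A.det x₀ ≠ 0 := by
    rw [hdet]
    intro h0
    obtain ⟨c, hc, hAc⟩ := Matrix.exists_mulVec_eq_zero_iff.2 h0
    have h1 : ∑ k, c k • α k x₀ = 0 := by
      refine ν.eq_zero_of_forall_apply_sharp (hαmem x₀ c) fun w hw => ?_
      have h2 := congrArg Subtype.val (b.sum_repr ⟨w, hw⟩)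
      rw [AddSubmonoidClass.coe_finsetSum] at h2
      change _ = w at h2
      rw [← h2, LinearMap.sum_apply]
      refine Finset.sum_eq_zero fun j _ => ?_
      rw [Submodule.coe_smul, LinearMap.smul_apply, ← hα₀, hApp, hAc, Pi.zero_apply, smul_zero]
    simp only [hα₀] at h1
    have h3 : ∑ k, c k • b k = 0 := by
      apply Subtype.ext
      rw [AddSubmonoidClass.coe_finsetSum]
      exact h1
    exact hc (b.equivFun.symm.map_eq_zero_iff.1 ((b.equivFun_symm_apply c).trans h3))
  have key : ∀ y, A.det y ≠ 0 → A.det y • ν.flat y (X y) = β y := by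
    intro y hy
    have hAy : ((ev y).mapMatrix A).det ≠ 0 := by rwa [← hdet]
    let w : Fin r → Λ.leafTangent y := fun k => ⟨Λ.sharp y (α k y), ⟨_, rfl⟩⟩
    have hli : LinearIndependent ℝ w := by
      rw [Fintype.linearIndependent_iff]
      intro c hc
      have h1 : Λ.sharp y (∑ k, c k • α k y) = 0 := by
        have := congrArg Subtype.val hc
        rw [AddSubmonoidClass.coe_finsetSum] at this
        rw [map_sum]
        simp only [map_smul]
        exact this
      have : ((ev y).mapMatrix A).mulVec c = 0 := by
        ext j
        rw [← hApp, h1, map_zero]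
        rfl
      exact congrFun (Matrix.eq_zero_of_mulVec_eq_zero hAy this)
    -- Constant rank is decisive here: r independent vectors span the leaf tangent space at y only
    -- because its dimension is still r.
    have hspan : ⊤ ≤ Submodule.span ℝ (Set.range w) := by
      rw [hli.span_eq_top_of_card_eq_finrank']
      rw [Fintype.card_fin, hr]
    obtain ⟨c, hc⟩ := (Submodule.mem_span_range_iff_exists_fun ℝ).1
      (hspan (x := ⟨ν.proj y (X y), ν.proj_mem y _⟩) trivial)
    have hc' : Λ.sharp y (∑ k, c k • α k y) = ν.proj y (X y) := by
      have := congrArg Subtype.val hc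
      rw [AddSubmonoidClass.coe_finsetSum] at this
      rw [map_sum]
      simp only [map_smul]
      exact this
    have hflat : ν.flat y (X y) = ∑ k, c k • α k y :=
      ν.eq_of_sharp_eq (ν.flat_comp_proj y _) (hαmem y c) (by rw [sharp_flat, hc'])
    -- The values α_j(X) at y equal A c, as the α_j do not see the part of X in νF; multiplying by
    -- the adjugate turns A c into det(A) c.
    have hu : ∀ k, u k y = ((ev y).mapMatrix A).det * c k := by
      have h2 : (fun j => α j y (X y)) = ((ev y).mapMatrix A).mulVec c := by
        ext j
        rw [← hApp, hc', ← LinearMap.comp_apply, hα]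
      have h1 : (fun k => u k y) =
          ((ev y).mapMatrix A).adjugate.mulVec (((ev y).mapMatrix A).mulVec c) := by
        have h3 : ((ev y).mapMatrix A).adjugate = (ev y).mapMatrix A.adjugate :=
          ((ev y).map_adjugate A).symm
        rw [← h2, h3]
        ext k
        exact (ev y).map_mulVec A.adjugate _ k
      rw [Matrix.mulVec_mulVec, Matrix.adjugate_mul, Matrix.smul_mulVec, Matrix.one_mulVec] at h1
      exact fun k => congrFun h1 k
    have hβ : β y = ∑ k, u k y • α k y :=
      coe_sum_section (E := E) (V := CotangentSpace E M) _ _ y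
    rw [hβ, hflat, Finset.smul_sum, hdet]
    exact Finset.sum_congr rfl fun k _ => by rw [hu, smul_smul]
  have hne : ∀ᶠ y in 𝓝 x₀, A.det y ≠ 0 :=
    A.det.contMDiff.continuous.continuousAt.eventually_ne hdet0
  have hinv : ContMDiffAt 𝓘(ℝ, E) 𝓘(ℝ, ℝ) ∞ (fun y => (A.det y)⁻¹) x₀ :=
    (A.det.contMDiff x₀).inv₀ hdet0
  refine (hinv.mul (β.smooth Y x₀)).congr_of_eventuallyEq ?_
  filter_upwards [hne] with y hy
  change _ = (A.det y)⁻¹ * β y (Y y)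
  rw [← key y hy, LinearMap.smul_apply, smul_eq_mul, inv_mul_cancel_left₀ hy]

/-- The 1-form in `T*F` corresponding to the tangential part of a vector field. -/
def flatField (hreg : Λ.IsRegular) (X : VectorFields E M) : OneForms E M :=
  ⟨fun x => ν.flat x (X x), ν.contMDiff_flat hreg X⟩

theorem sharpField_flatField (hreg : Λ.IsRegular) (X : VectorFields E M) :
    Λ.sharpField (ν.flatField hreg X) = ν.projField X := by
  ext x
  exact ν.sharp_flat x (X x)

end Multivectors.Transversal

end Flat

/-! ### Comparison of d'' and σ'' by pullback along `♯` -/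

section Comparison

variable {E : Type*} [NormedAddCommGroup E] [NormedSpace ℝ E] [FiniteDimensional ℝ E]
  {M : Type*} [TopologicalSpace M] [T2Space M] [ChartedSpace E M] [IsManifold 𝓘(ℝ, E) ∞ M]
  {q : ℕ}

theorem AlternatingField.zsmul_apply {V : M → Type*} [∀ x, AddCommGroup (V x)]
    [∀ x, Module ℝ (V x)] {L : Type*} [DFunLike L M V] (n : ℤ) (P : AlternatingField E V L q)
    (x : M) : (n • P) x = n • P x :=
  map_zsmul (AddMonoidHom.mk' (fun P : AlternatingField E V L q => P x) fun _ _ => rfl) n P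

namespace Multivectors

variable (Λ : Multivectors E M 2)

/-- The pullback `η(α_1^♯,…,α_q^♯)` of a form along `♯`. -/
def pullbackSharp (η : Forms E M q) : Multivectors E M q :=
  ⟨fun x => (η x).compLinearMap (Λ.sharp x), fun α => η.smooth fun i => Λ.sharpField (α i)⟩

/-- With its sign (-1)^q, `sharpForm` anticommutes with the differentials. The unsigned pullback
commutes with them, and this identity relates the two. -/
theorem pullbackSharp_eq (η : Forms E M q) :
    Λ.pullbackSharp η = (-1 : ℤ) ^ q • Λ.sharpForm η := by
  ext x a
  rw [AlternatingField.zsmul_apply]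
  change η x _ = (-1 : ℤ) ^ q • ((-1 : ℝ) ^ q * η x _)
  rw [zsmul_eq_mul, ← mul_assoc]
  push_cast
  rw [← mul_pow]
  norm_num

theorem pullbackSharp_mem (η : Forms E M q) : Λ.pullbackSharp η ∈ Λ.tangential q := by
  rintro x a ⟨i, hi⟩
  exact (η x).map_coord_zero i ((Λ.sharp_eq_zero_iff x _).2 hi)

variable {Λ}

/-- The Koszul expression of `σ` on a pullback along `♯` is that of `d`. -/
theorem koszul_pullbackSharp {B : PoissonBracket E M} (hΛ : B.IsBivector Λ) (η : Forms E M q)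
    (α : Fin (q + 1) → OneForms E M) :
    Λ.cotangentBracket.koszul (Λ.pullbackSharp η).onSections α =
      (tangentBracket E M).koszul η.onSections (Λ.sharpField ∘ α) :=
  AnchoredBracket.koszul_comp _ _ Λ.sharpField (sharpField_bracket hΛ) (fun _ => rfl) _ _
    (fun _ => rfl) α

namespace Transversal

variable (ν : Λ.Transversal)

theorem sharpField_projOneForm (α : OneForms E M) :
    Λ.sharpField (ν.projOneForm α) = Λ.sharpField α := by
  ext x
  exact ν.sharp_comp_proj x (α x)

theorem projField_sharpField (α : OneForms E M) :
    ν.projField (Λ.sharpField α) = Λ.sharpField α := by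
  ext x
  exact ν.proj_sharp x (α x)

/-- The form of type `(0, q)` which corresponds to a `q`-vector field. -/
def flatForm (hreg : Λ.IsRegular) (Q : Multivectors E M q) : Forms E M q :=
  ⟨fun x => (Q x).compLinearMap (ν.flat x), fun X => Q.smooth fun i => ν.flatField hreg (X i)⟩

theorem flatForm_mem (hreg : Λ.IsRegular) (Q : Multivectors E M q) :
    ν.flatForm hreg Q ∈ ν.leafForms q := by
  rintro x v ⟨i, hi⟩
  exact (Q x).map_coord_zero i (ν.flat_eq_zero hi)

/-- The isomorphism `Ω_{0,q}(M) ≃ 𝒱_{0,q}(M)` given by pullback along `♯`. -/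
def leafFormsEquiv (hreg : Λ.IsRegular) (q : ℕ) : ν.leafForms q ≃ₗ[Λ.casimirs] Λ.tangential q where
  toFun η := ⟨Λ.pullbackSharp η, Λ.pullbackSharp_mem _⟩
  invFun Q := ⟨ν.flatForm hreg Q, ν.flatForm_mem hreg _⟩
  map_add' _ _ := rfl
  map_smul' _ _ := rfl
  left_inv η := Subtype.ext <| by
    ext x v
    change (η : Forms E M q) x (fun i => Λ.sharp x (ν.flat x (v i))) = (η : Forms E M q) x v
    -- The composite `♯` after `flat` is the projection to TF, which moves a vector only by an
    -- element of νF.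
    refine AlternatingMap.congr_of_sub_mem _ (ν.space x) (η.2 x) fun i => ?_
    rw [sharp_flat, ← neg_sub]
    exact neg_mem (ν.sub_proj_mem x (v i))
  right_inv Q := Subtype.ext <| by
    ext x a
    change (Q : Multivectors E M q) x (fun i => ν.flat x (Λ.sharp x (a i))) =
      (Q : Multivectors E M q) x a
    -- A covector and `flat` of its image under `♯` have the same image, so they differ by an
    -- element of ν*F.
    refine AlternatingMap.congr_of_sub_mem _ _ (Q.2 x) fun i => ?_
    rw [← sharp_eq_zero_iff, map_sub, sharp_flat, proj_sharp, sub_self]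

/-- Pullback along `♯` intertwines `d''` and `σ''`. -/
theorem leafFormsEquiv_leafD {B : PoissonBracket E M} (hΛ : B.IsBivector Λ)
    (hreg : Λ.IsRegular) (η : ν.leafForms q) :
    ν.leafFormsEquiv hreg (q + 1) (ν.leafD q η) =
      ν.tangentialSigma q (ν.leafFormsEquiv hreg q η) :=
  Subtype.ext <| AlternatingField.ext_sections fun α x => by
    change (η : Forms E M q).d x (fun i => ν.projField (Λ.sharpField (α i)) x) =
      Λ.sigma (Λ.pullbackSharp (η : Forms E M q)) x (fun i => ν.projOneForm (α i) x)
    rw [Forms.d_apply, sigma_apply, koszul_pullbackSharp hΛ]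
    -- Both projections are redundant: `♯` has values in TF and ignores ν*F.
    have h : (fun i => ν.projField (Λ.sharpField (α i))) =
        Λ.sharpField ∘ fun i => ν.projOneForm (α i) := funext fun i =>
      (ν.projField_sharpField (α i)).trans (ν.sharpField_projOneForm (α i)).symm
    rw [h]

/-- Every vector field tangent to the leaves is α^♯ for a 1-form α. On such fields the Koszul
expression of a form depends only on its pullback along `♯`, because their brackets stay in im ♯; so
the component d''η may be replaced by dη, and d ∘ d = 0 applies. -/
theorem leafD_leafD {B : PoissonBracket E M} (hΛ : B.IsBivector Λ) (hreg : Λ.IsRegular)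
    (η : ν.leafForms q) : ν.leafD (q + 1) (ν.leafD q η) = 0 :=
  Subtype.ext <| AlternatingField.ext_sections fun X x => by
    change (ν.formComponent (η : Forms E M q).d).d x (fun i => ν.projField (X i) x) = 0
    have h : (fun i => ν.projField (X i)) = Λ.sharpField ∘ fun i => ν.flatField hreg (X i) :=
      funext fun i => (ν.sharpField_flatField hreg (X i)).symm
    have hc : Λ.pullbackSharp (ν.formComponent (η : Forms E M q).d) =
        Λ.pullbackSharp (η : Forms E M q).d := by
      ext y a
      exact congrArg ((η : Forms E M q).d y) (funext fun i => ν.proj_sharp y (a i))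
    -- The expression passes to the cotangent side, where the component and the full form have the
    -- same pullback, and then back to the tangent side.
    rw [Forms.d_apply, h, ← koszul_pullbackSharp hΛ, hc, koszul_pullbackSharp hΛ,
      Forms.onSections_d, koszul_koszulMap]
    rfl

end Transversal

end Multivectors

end Comparison

/-! ### Cohomology of isomorphic complexes -/

section CohomologyEquiv

variable {R : Type*} [CommRing R] {C C' : ℕ → Type*} [∀ q, AddCommGroup (C q)]
  [∀ q, Module R (C q)] [∀ q, AddCommGroup (C' q)] [∀ q, Module R (C' q)]
  {d : ∀ q, C q →ₗ[R] C (q + 1)} {d' : ∀ q, C' q →ₗ[R] C' (q + 1)}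

/-- An isomorphism of complexes induces an isomorphism in cohomology. -/
theorem Cohomology.exists_equiv (Φ : ∀ q, C q ≃ₗ[R] C' q)
    (h : ∀ q c, Φ (q + 1) (d q c) = d' q (Φ q c)) (q : ℕ) :
    ∃ Ψ : Cohomology d' q ≃ₗ[R] Cohomology d q, ∀ (c' : LinearMap.ker (d' q))
      (c : LinearMap.ker (d q)), (c' : C' q) = Φ q c → Ψ (Cohomology.mk d' q c') =
        Cohomology.mk d q c := by
  have hker : ∀ c, c ∈ LinearMap.ker (d q) ↔ Φ q c ∈ LinearMap.ker (d' q) := fun c => by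
    rw [LinearMap.mem_ker, LinearMap.mem_ker, ← h, LinearEquiv.map_eq_zero_iff]
  -- In degree 0 the coboundaries are zero by definition; in higher degrees surjectivity of Φ in the
  -- preceding degree is needed.
  have hcob : ∀ c, c ∈ coboundaries d q ↔ Φ q c ∈ coboundaries d' q := fun c => by
    cases q with
    | zero => exact (LinearEquiv.map_eq_zero_iff (Φ 0)).symm
    | succ q =>
      constructor
      · rintro ⟨b, rfl⟩
        exact ⟨Φ q b, (h q b).symm⟩
      · rintro ⟨b, hb⟩
        refine ⟨(Φ q).symm b, (Φ (q + 1)).injective ?_⟩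
        rw [h, LinearEquiv.apply_symm_apply, hb]
  let e : LinearMap.ker (d q) ≃ₗ[R] LinearMap.ker (d' q) :=
    (Φ q).ofSubmodules _ _ (by
      ext c'
      rw [Submodule.mem_map]
      constructor
      · rintro ⟨c, hc, rfl⟩
        exact (hker c).1 hc
      · intro hc
        exact ⟨(Φ q).symm c', (hker _).2 (by rwa [LinearEquiv.apply_symm_apply]),
          (Φ q).apply_symm_apply c'⟩)
  let F : Cohomology d q ≃ₗ[R] Cohomology d' q := Submodule.Quotient.equiv _ _ e (by
    ext c'
    rw [Submodule.mem_map]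
    constructor
    · rintro ⟨c, hc, rfl⟩
      exact (hcob c).1 hc
    · intro hc
      refine ⟨e.symm c', (hcob _).2 ?_, e.apply_symm_apply c'⟩
      change (e (e.symm c') : C' q) ∈ _
      rw [LinearEquiv.apply_symm_apply]
      exact hc)
  refine ⟨F.symm, fun c' c hc => ?_⟩
  obtain rfl : c' = e c := Subtype.ext hc
  exact F.symm_apply_apply (Cohomology.mk d q c)

end CohomologyEquiv

end PoissonGeometry

end

open PoissonGeometry PoissonGeometry.Multivectors in
theorem theorem1
    {E : Type*} [NormedAddCommGroup E] [NormedSpace ℝ E] [FiniteDimensional ℝ E]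
    {M : Type*} [TopologicalSpace M] [T2Space M] [ChartedSpace E M]
    [IsManifold (modelWithCornersSelf ℝ E) ((⊤ : ℕ∞) : WithTop ℕ∞) M]
    (B : PoissonBracket E M) (Λ : Multivectors E M 2) (hΛ : B.IsBivector Λ)
    (hreg : Λ.IsRegular) (ν : Λ.Transversal) :
    (∀ q, ν.leafD (q + 1) ∘ₗ ν.leafD q = 0) ∧
    (∀ q, ν.tangentialSigma (q + 1) ∘ₗ ν.tangentialSigma q = 0) ∧
    ∃ Φ : ∀ q : ℕ, ν.leafForms q ≃ₗ[Λ.casimirs] Λ.tangential q,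
      (∀ q (η : ν.leafForms q),
        (Φ q η : Multivectors E M q) = (-1 : ℤ) ^ q • Λ.sharpForm (η : Forms E M q)) ∧
      (∀ q (η : ν.leafForms q), Φ (q + 1) (ν.leafD q η) = ν.tangentialSigma q (Φ q η)) ∧
      ∃ Ψ : ∀ q : ℕ, ν.TangentialCohomology q ≃ₗ[Λ.casimirs] ν.LeafCohomology q,
        ∀ q (Q : LinearMap.ker (ν.tangentialSigma q)) (η : LinearMap.ker (ν.leafD q)),
          (Q : Λ.tangential q) = Φ q η →
            Ψ q (ν.tangentialClass q Q) = ν.leafClass q η := by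
  have hΦ : ∀ q (η : ν.leafForms q), ν.leafFormsEquiv hreg (q + 1) (ν.leafD q η) =
      ν.tangentialSigma q (ν.leafFormsEquiv hreg q η) := fun _ η =>
    ν.leafFormsEquiv_leafD hΛ hreg η
  refine ⟨fun q => LinearMap.ext fun η => ν.leafD_leafD hΛ hreg η,
    fun q => LinearMap.ext fun Q => ?_, ν.leafFormsEquiv hreg,
    fun q η => Λ.pullbackSharp_eq (η : Forms E M q), hΦ, ?_⟩
  -- The square of σ'' is computed on the form side, so no Jacobi identity for the bracket of
  -- 1-forms is required.
  · obtain ⟨η, rfl⟩ := (ν.leafFormsEquiv hreg q).surjective Q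
    rw [LinearMap.comp_apply, ← hΦ, ← hΦ, ν.leafD_leafD hΛ hreg, map_zero]
    rfl
  · choose Ψ hΨ using Cohomology.exists_equiv (ν.leafFormsEquiv hreg) hΦ
    exact ⟨Ψ, hΨ⟩
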